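/- **Setting.** Let $G$ be a finite abelian group acting linearly on a real vector space $V$ of finite dimension $n$. Fix complex linear coordinates $x^1,\dots,x^n$ on $V$ that are eigenfunctions of all $g\in G$, and write $\partial_i=\partial/\partial x^i$. Let $A=\mathrm{Poly}(V)$ be the algebra of (complex valued) polynomial functions on $V$, with $(g f)(v)=f(g^{-1}v)$, and $A\rtimes G=\{\sum_g a_gU_g\}$, $U_g a=g(a)U_g$. For $g\in G$ let $V^g$ be its fixed space, $N^g$ the invariant complement of $V^g$, $l(g)=\dim N^g$, let $y^1,\dots,y^{l(g)}$ be those $x^i$ which are not fixed by $g$ (in increasing order of $i$), $\tilde y^r=g(y^r)$, and $\Lambda_g=\frac{\partial}{\partial y^1}\wedge\dots\wedge\frac{\partial}{\partial y^{l(g)}}$. Let $\Gamma_g^k=\Gamma(\wedge^{k-l(g)}TV^g\otimes\wedge^{l(g)}N^g)$ denote the space of polynomial sections over $V^g$ (zero for $k<l(g)$); its elements are $X\otimes\Lambda_g$ with $X=\sum_{i_1<\dots<i_m}X^{i_1\cdots i_m}\partial_{i_1}\wedge\dots\wedge\partial_{i_m}$, $m=k-l(g)$, the $x^{i}$ being coordinates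 on $V^g$ and the coefficients being extended antisymmetrically in the indices. Functions on $V^g$ are regarded as functions on $V=V^g\oplus N^g$ that are constant along $N^g$. *The map $T$.* Put $$\Omega_g(f_1,\dots,f_{l(g)})=\frac1{l(g)!}\sum_{\sigma\in S_{l(g)}}(-1)^\sigma\prod_{r=1}^{l(g)}\frac{f_r(z_\sigma^{r-1})-f_r(z_\sigma^{r})}{y^{\sigma(r)}-\tilde y^{\sigma(r)}},$$ where $z_\sigma^r$ arises from the coordinate vector by replacing $y^{\sigma(1)},\dots,y^{\sigma(r)}$ by $\tilde y^{\sigma(1)},\dots,\tilde y^{\sigma(r)}$. Put $T_1^g(X\otimes\Lambda_g)(f_1,\dots,f_k)=X(f_1,\dots,f_m)\,\Omega_g(f_{m+1},\dots,f_k)$, where $X$ acts as the multidifferential operator in which $\partial_{i_1}\wedge\dots\wedge\partial_{i_m}$ is $\frac1{m!}\sum_\sigma(-1)^\sigma\partial_{i_{\sigma(1)}}\otimes\dots\otimes\partial_{i_{\sigma(m)}}$. For $\xi=\sum_g\xi_g\in\bigoplus_g\Gamma^k_g$ let $T_1(\xi)=\sum_gT_1^g(\xi_g)U_g$ and $$T(\xi)(a_1U_{g_1},\dots,a_kU_{g_k})=T_1(\xi)\big(a_1,g_1(a_2),\dots,g_1\cdots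 g_{k-1}(a_k)\big)U_{g_1\cdots g_k},$$ a cochain in $C^k(A\rtimes G,A\rtimes G)=\mathrm{Hom}((A\rtimes G)^{\otimes k},A\rtimes G)$. *The map $L$.* For $\Psi\in C^N(A\rtimes G,A\rtimes G)$ let $L_1(\Psi)(f_1,\dots,f_N)=\frac1{|G|}\sum_gU_{g^{-1}}\Psi(g(f_1),\dots,g(f_N))U_g=\sum_g\Psi_g(f_1,\dots,f_N)U_g$ for $f_i\in A$, let $$L_2^g(\Psi_g)(p)=\sum_{i_1,\dots,i_N}\frac1{N!}\sum_{\sigma\in S_N}(-1)^\sigma\,\Psi_g\big(x^{i_{\sigma^{-1}(1)}}-p^{i_{\sigma^{-1}(1)}},\dots,x^{i_{\sigma^{-1}(N)}}-p^{i_{\sigma^{-1}(N)}}\big)(p)\;\partial_{i_1}\wedge\dots\wedge\partial_{i_N},$$ and let the $g$-component of $L(\Psi)\in\bigoplus_g\Gamma_g^N$ be the restriction of $L_2^g(\Psi_g)$ to $V^g$, projected from $\wedge^N(TV^g\oplus N^g)$ to $\wedge^{N-l(g)}TV^g\otimes\wedge^{l(g)}N^g$. *The pre-Lie product.* For $\phi\in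 C^k$, $\psi\in C^l$, $$(\phi\circ\psi)(a_1,\dots,a_{k+l-1})=\sum_{i=1}^k(-1)^{(i-1)(l-1)}\phi(a_1,\dots,a_{i-1},\psi(a_i,\dots,a_{i+l-1}),a_{i+l},\dots,a_{k+l-1}).$$ **Theorem.** Let $\xi=\sum_\alpha X_\alpha\otimes\Lambda_\alpha\in\big(\bigoplus_\alpha\Gamma_\alpha^k\big)^G$ and $\eta=\sum_\beta Y_\beta\otimes\Lambda_\beta\in\big(\bigoplus_\beta\Gamma_\beta^l\big)^G$. 1. If $V^\alpha+V^\beta\neq V$ for all $\alpha,\beta$ with $\xi_\alpha\ne0$ and $\eta_\beta\ne0$, then $L(T(\xi)\circ T(\eta))=0$. (In particular, if $\xi$ is supported at $\alpha$, $\eta$ at $\beta$, and $V^\alpha+V^\beta\ne V$.) 2. If $V^\alpha+V^\beta=V$, then $V=V^{\alpha\beta}\oplus N^\alpha\oplus N^\beta$, $V^\alpha=V^{\alpha\beta}\oplus N^\beta$, $V^\beta=V^{\alpha\beta}\oplus N^\alpha$ and $l(\alpha\beta)=l(\alpha)+l(\beta)$. For every $g\in G$ the component of $L(T(\xi)\circ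 T(\eta))$ in $\Gamma(\wedge^{k+l-1-l(g)}TV^g\otimes\wedge^{l(g)}N^g)$ is $$\sum_{\substack{g=\lambda\mu\\ l(g)=l(\lambda)+l(\mu)}}\Big[\sum_{\substack{i_1<\dots<i_m\\ j_1<\dots<j_p}}\ \sum_{z=1}^{m}(-1)^{(z-1)(l-1)+(k-z)l+(l-l(\mu))l(\lambda)}X_\lambda^{i_1\cdots i_m}\,\frac{\partial Y_\mu^{j_1\cdots j_p}}{\partial x^{i_z}}\;\partial_{i_1}\wedge\cdots\widehat{\partial_{i_z}}\cdots\wedge\partial_{i_m}\wedge\partial_{j_1}\wedge\cdots\wedge\partial_{j_p}\wedge\Lambda_\lambda\wedge\Lambda_\mu$$ $$\qquad+\sum_{\substack{i_1<\dots<i_m\\ j_1<\dots<j_{p-1}}}\ \sum_{q}(-1)^{(k-l(\lambda))(l-1)+l(\mu)(l(\lambda)-1)}X_\lambda^{i_1\cdots i_m}\,\frac{\partial Y_\mu^{j_1\cdots j_{p-1}q}}{\partial x^{q}}\;\partial_{i_1}\wedge\cdots\wedge\partial_{i_m}\wedge\partial_{j_1}\wedge\cdots\wedge\partial_{j_{p-1}}\wedge\Lambda_\lambda\wedge\Lambda_\mu\Big],$$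 where $m=k-l(\lambda)$, $p=l-l(\mu)$, the $i$'s and $j$'s run over (the indices of) coordinates on $V^g$, $q$ runs over coordinates on $N^\lambda$, all coefficients are restricted to $V^g$ after differentiation, and the second sum is absent if $p=0$. -/

import Mathlib

open MvPolynomial TensorProduct

namespace OrbifoldBracket

noncomputable section

/-! ## The linear action

A finite abelian group `G` acts linearly on a real vector space `V` of dimension `n`; we fix complex
linear coordinates `x^1, …, x^n` on `V` which are eigenfunctions of every `g`, with characters
`χ i`, i.e. `x^i (g⁻¹ v) = χ i g * x^i v`. -/

section Linear

variable {G V : Type*} [Group G] [AddCommGroup V] [Module ℝ V]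

/-- `V^g`, the subspace of vectors fixed by `g`. -/
def fixedSpace (ρ : Representation ℝ G V) (g : G) : Submodule ℝ V :=
  LinearMap.ker (ρ g - 1)

/-- `N^g = (1 - g) V`: for `g` of finite order this is the only `g`-invariant complement of `V^g`,
that is, the sum of all nontrivial irreducible subrepresentations of the cyclic group generated by
`g`, and the orthogonal complement of `V^g` for every invariant inner product. -/
def normalSpace (ρ : Representation ℝ G V) (g : G) : Submodule ℝ V :=
  LinearMap.range (ρ g - 1)

/-- The complex linear coordinates `x` on `V` are eigenfunctions of all `g`, with characters `χ`. -/
def IsEigenCoordinates {n : ℕ} (ρ : Representation ℝ G V)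
    (x : Module.Basis (Fin n) ℂ (V →ₗ[ℝ] ℂ)) (χ : Fin n → G →* ℂˣ) : Prop :=
  ∀ (i : Fin n) (g : G) (v : V), x i (ρ g⁻¹ v) = (χ i g : ℂ) * x i v

end Linear

section Coordinates

variable {G : Type*} [CommGroup G] {n : ℕ} (χ : Fin n → G →* ℂˣ)

open Classical in
/-- The indices of the coordinates on `V^g`. -/
def tang (g : G) : Finset (Fin n) := Finset.univ.filter fun i => χ i g = 1

open Classical in
/-- The indices of the coordinates `y^1, …, y^{l(g)}` on `N^g`. -/
def normal (g : G) : Finset (Fin n) := Finset.univ.filter fun i => χ i g ≠ 1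

/-- `l(g) = dim N^g` (see `codim_eq_finrank`). -/
def codim (g : G) : ℕ := (normal χ g).card

/-- The index of the normal coordinate `y^r`. -/
def yIdx (g : G) : Fin (codim χ g) → Fin n := (normal χ g).orderEmbOfFin rfl

variable {V : Type*} [AddCommGroup V] [Module ℝ V]

theorem codim_eq_finrank [FiniteDimensional ℝ V] (ρ : Representation ℝ G V)
    (x : Module.Basis (Fin n) ℂ (V →ₗ[ℝ] ℂ))
    (hχ : IsEigenCoordinates ρ x χ) (g : G) :
    codim χ g = Module.finrank ℝ (normalSpace ρ g) := by
  have hinv : ∀ v, ρ g (ρ g⁻¹ v) = v := fun v => by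
    rw [← Module.End.mul_apply, ← map_mul]; simp
  set d : V →ₗ[ℝ] V := ρ g⁻¹ - 1 with hd
  have hr : normalSpace ρ g = LinearMap.range d := by
    ext w
    simp only [normalSpace, LinearMap.mem_range, hd, LinearMap.sub_apply, Module.End.one_apply]
    have hinv' : ∀ v, ρ g⁻¹ (ρ g v) = v := fun v => by
      rw [← Module.End.mul_apply, ← map_mul]; simp
    constructor
    · rintro ⟨v, rfl⟩; exact ⟨-(ρ g v), by simp [hinv']; abel⟩
    · rintro ⟨v, rfl⟩; exact ⟨-(ρ g⁻¹ v), by simp [hinv]; abel⟩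
  rw [hr]
  -- precomposition with `d`, which is diagonal in the coordinates
  let P : (LinearMap.range d →ₗ[ℝ] ℂ) →ₗ[ℂ] (V →ₗ[ℝ] ℂ) :=
    { toFun := fun f => f ∘ₗ d.rangeRestrict
      map_add' := fun _ _ => rfl
      map_smul' := fun _ _ => rfl }
  have hP : Function.Injective P := by
    intro f f' h
    ext w
    obtain ⟨v, hv⟩ := d.surjective_rangeRestrict w
    rw [← hv]; exact LinearMap.congr_fun h v
  have hx : ∀ i, (x i) ∘ₗ d = ((χ i g : ℂ) - 1) • x i := by
    intro i; ext v
    simp [hd, hχ i g v, sub_mul]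
  have hrange : LinearMap.range P = Submodule.span ℂ (Set.range fun i : normal χ g => x i) := by
    apply le_antisymm
    · rintro _ ⟨f, rfl⟩
      obtain ⟨F, hF⟩ := LinearMap.exists_extend f
      have h1 : P f = F ∘ₗ d := by
        ext v; change f (d.rangeRestrict v) = F (d v)
        rw [← hF]; rfl
      rw [h1, ← x.sum_repr F]
      have h2 : (∑ i, x.repr F i • x i) ∘ₗ d = ∑ i, x.repr F i • (((χ i g : ℂ) - 1) • x i) := by
        simp only [← hx]; ext v
        simp only [LinearMap.comp_apply, LinearMap.sum_apply, LinearMap.smul_apply]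
      rw [h2]
      refine Submodule.sum_mem _ fun i _ => ?_
      by_cases hi : χ i g = 1
      · simp [hi]
      · exact Submodule.smul_mem _ _ (Submodule.smul_mem _ _
          (Submodule.subset_span ⟨⟨i, by simp [normal, hi]⟩, rfl⟩))
    · rw [Submodule.span_le]
      rintro _ ⟨⟨i, hi⟩, rfl⟩
      have hi' : χ i g ≠ 1 := by simpa [normal] using hi
      have hc : (χ i g : ℂ) - 1 ≠ 0 := fun h => hi' (Units.ext (by simpa [sub_eq_zero] using h))
      refine ⟨((χ i g : ℂ) - 1)⁻¹ • (x i ∘ₗ (LinearMap.range d).subtype), ?_⟩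
      have : P (((χ i g : ℂ) - 1)⁻¹ • (x i ∘ₗ (LinearMap.range d).subtype)) =
          ((χ i g : ℂ) - 1)⁻¹ • (x i ∘ₗ d) := rfl
      rw [this, hx, smul_smul, inv_mul_cancel₀ hc, one_smul]
  have h1 : Module.finrank ℂ (LinearMap.range P) = codim χ g := by
    rw [hrange]
    refine (finrank_span_eq_card (R := ℂ) (b := fun i : normal χ g => x i)
      (x.linearIndependent.comp _ Subtype.val_injective)).trans ?_
    simp [codim]
  rw [← h1, LinearMap.finrank_range_of_inj hP, Module.finrank_linearMap_self]

end Coordinates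

/-! ## Polynomial functions and the crossed product -/

/-- Complex valued polynomial functions on `V`, as polynomials in the coordinates `x^1, …, x^n`. -/
abbrev Poly (n : ℕ) : Type := MvPolynomial (Fin n) ℂ

section Algebra

variable {G : Type*} [CommGroup G] {n : ℕ} (χ : Fin n → G →* ℂˣ)

/-- The action of `g` on functions, `(g f)(v) = f(g⁻¹ v)`. -/
def act (g : G) : Poly n →ₐ[ℂ] Poly n := aeval fun i => C (χ i g : ℂ) * X i

theorem act_one : act χ 1 = AlgHom.id ℂ (Poly n) := by
  ext1 i; simp [act]

theorem act_mul (g h : G) : act χ (g * h) = (act χ g).comp (act χ h) := by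
  ext1 i; simp [act]; ring

/-- The action on functions, in the form needed for Mathlib's crossed product. -/
@[reducible] def polyAction : MulSemiringAction G (Poly n) where
  smul g f := act χ g f
  one_smul f := by change act χ 1 f = f; simp [act_one]
  mul_smul g h f := by change act χ (g * h) f = act χ g (act χ h f); simp [act_mul]
  smul_zero g := map_zero (act χ g)
  smul_add g := map_add (act χ g)
  smul_one g := map_one (act χ g)
  smul_mul g := map_mul (act χ g)

/-- `Poly(V) ⋊ G`, with elements `∑ a_g U_g`. Its multiplication
`(a U_g) (b U_h) = a g(b) U_{gh}` is the one defined by `polyAction χ`. -/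
abbrev Crossed (G : Type*) (n : ℕ) : Type _ := SkewMonoidAlgebra (Poly n) G

/-- The coefficient of `U_g`. -/
def coeffAt (g : G) : Crossed G n →ₗ[ℂ] Poly n :=
  (Finsupp.lapply g).comp
    (SkewMonoidAlgebra.coeffLinearEquiv (S := ℂ) (k := Poly n) (G := G)).toLinearMap

/-- `b ↦ b * U_g`. -/
def mulU (g : G) : Crossed G n →ₗ[ℂ] Crossed G n :=
  letI := polyAction χ
  { toFun := fun b => b * SkewMonoidAlgebra.single g 1
    map_add' := fun a b => add_mul a b _
    map_smul' := fun c b => by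
      ext x
      simp [SkewMonoidAlgebra.coeff_mul_single] }

/-- `b ↦ U_{g⁻¹} * b * U_g`. -/
def conjU (g : G) : Crossed G n →ₗ[ℂ] Crossed G n :=
  letI := polyAction χ
  { toFun := fun b => SkewMonoidAlgebra.single g⁻¹ 1 * b * SkewMonoidAlgebra.single g 1
    map_add' := fun a b => by rw [mul_add, add_mul]
    map_smul' := fun c b => by
      ext1 x
      simp only [SkewMonoidAlgebra.coeff_mul_single, SkewMonoidAlgebra.coeff_single_mul,
        SkewMonoidAlgebra.coeff_smul, Finsupp.smul_apply, RingHom.id_apply, one_mul]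
      rw [show ∀ (h : G) (f : Poly n), h • f = act χ h f from fun _ _ => rfl, map_smul,
        smul_mul_assoc]
      rfl }

end Algebra

/-! ## Hochschild cochains and the pre-Lie product -/

/-- Hochschild cochains `C^k(B, M) = Hom(B^{⊗ k}, M)`. -/
abbrev Cochain (k : ℕ) (B M : Type*) [AddCommGroup B] [Module ℂ B] [AddCommGroup M] [Module ℂ M] :=
  MultilinearMap ℂ (fun _ : Fin k => B) M

section PreLie

variable {B : Type*} [AddCommGroup B] [Module ℂ B]

/-- The arguments of `φ` in `φ(a_1, …, a_s, ψ(a_{s+1}, …, a_{s+l}), a_{s+l+1}, …, a_{k+l-1})`. -/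
def insertArgs {k l : ℕ} (ψ : Cochain l B B) (s : Fin k) (a : Fin (k + l - 1) → B) (r : Fin k) : B :=
  if h : r < s then a ⟨r, by omega⟩
  else if h' : r = s then ψ fun t => a ⟨s + t, by omega⟩
  else a ⟨r + l - 1, by omega⟩

theorem insertArgs_update {k l : ℕ} (ψ : Cochain l B B) (s : Fin k) (a : Fin (k + l - 1) → B)
    (j : Fin (k + l - 1)) :
    ∃ (r : Fin k) (F : B →ₗ[ℂ] B), ∀ v,
      insertArgs ψ s (Function.update a j v) = Function.update (insertArgs ψ s a) r (F v) := by
  rcases lt_or_ge j.1 s.1 with h1 | h1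
  · refine ⟨⟨j, by omega⟩, LinearMap.id, fun v => ?_⟩
    funext r
    by_cases hr : r = ⟨j, by omega⟩
    · subst hr
      simp [insertArgs, Fin.lt_def, h1]
    · rw [Function.update_of_ne hr]
      have hr' : r.1 ≠ j.1 := fun h => hr (Fin.ext h)
      unfold insertArgs
      split_ifs with h2 h3
      · exact Function.update_of_ne (fun h => hr' (by simpa using congrArg Fin.val h)) _ _
      · congr 1; funext t
        exact Function.update_of_ne (fun h => by have := congrArg Fin.val h; simp at this; omega) _ _
      · refine Function.update_of_ne (fun h => ?_) _ _
        have h4 := congrArg Fin.val h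
        have h5 : r.1 ≠ s.1 := fun h => h3 (Fin.ext h)
        have h6 : ¬ r.1 < s.1 := h2
        simp at h4; omega
  · rcases lt_or_ge j.1 (s.1 + l) with h2 | h2
    · refine ⟨s, ψ.toLinearMap (fun t => a ⟨s + t, by omega⟩) ⟨j - s, by omega⟩, fun v => ?_⟩
      funext r
      by_cases hr : r = s
      · subst hr
        simp only [insertArgs, lt_irrefl, dite_false, dite_true, Function.update_self,
          MultilinearMap.toLinearMap_apply]
        congr 1; funext t
        by_cases ht : t = ⟨j - r, by omega⟩
        · subst ht
          rw [Function.update_self]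
          have : (⟨r.1 + (j.1 - r.1), by omega⟩ : Fin (k + l - 1)) = j := Fin.ext (by simp; omega)
          simp only [this, Function.update_self]
        · rw [Function.update_of_ne ht, Function.update_of_ne]
          intro h
          apply ht
          have := congrArg Fin.val h
          exact Fin.ext (by simp at this ⊢; omega)
      · rw [Function.update_of_ne hr]
        have hr' : r.1 ≠ s.1 := fun h => hr (Fin.ext h)
        unfold insertArgs
        split_ifs with h3
        · have h3' : r.1 < s.1 := h3
          exact Function.update_of_ne (fun h => by have := congrArg Fin.val h; simp at this; omega) _ _
        · have h3' : ¬ r.1 < s.1 := h3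
          exact Function.update_of_ne (fun h => by have := congrArg Fin.val h; simp at this; omega) _ _
    · refine ⟨⟨j + 1 - l, by omega⟩, LinearMap.id, fun v => ?_⟩
      funext r
      by_cases hr : r = ⟨j + 1 - l, by omega⟩
      · subst hr
        have e1 : ¬ (j.1 + 1 - l < s.1) := by omega
        have e2 : ¬ (j.1 + 1 - l = s.1) := by omega
        have e3 : (⟨j.1 + 1 - l + l - 1, by omega⟩ : Fin (k + l - 1)) = j := Fin.ext (by simp; omega)
        simp [insertArgs, Fin.lt_def, Fin.ext_iff, e1, e2, e3]
      · rw [Function.update_of_ne hr]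
        have hr' : r.1 ≠ j.1 + 1 - l := fun h => hr (Fin.ext h)
        unfold insertArgs
        split_ifs with h3 h4
        · have h3' : r.1 < s.1 := h3
          exact Function.update_of_ne (fun h => by have := congrArg Fin.val h; simp at this; omega) _ _
        · congr 1; funext t
          exact Function.update_of_ne
            (fun h => by have := congrArg Fin.val h; simp at this; omega) _ _
        · have h3' : ¬ r.1 < s.1 := h3
          have h4' : r.1 ≠ s.1 := fun h => h4 (Fin.ext h)
          exact Function.update_of_ne (fun h => by have := congrArg Fin.val h; simp at this; omega) _ _

/-- `φ(a_1, …, a_s, ψ(a_{s+1}, …, a_{s+l}), a_{s+l+1}, …, a_{k+l-1})`. -/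
def insertAt {k l : ℕ} (φ : Cochain k B B) (ψ : Cochain l B B) (s : Fin k) :
    Cochain (k + l - 1) B B where
  toFun a := φ (insertArgs ψ s a)
  map_update_add' {inst} a j v w := by
    rw [Subsingleton.elim inst (instDecidableEqFin _)]
    obtain ⟨r, F, h⟩ := insertArgs_update ψ s a j
    simp only [h, map_add, MultilinearMap.map_update_add]
  map_update_smul' {inst} a j c v := by
    rw [Subsingleton.elim inst (instDecidableEqFin _)]
    obtain ⟨r, F, h⟩ := insertArgs_update ψ s a j
    simp only [h, map_smul, MultilinearMap.map_update_smul]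

/-- Gerstenhaber's pre-Lie product
`(φ ∘ ψ)(a_1, …) = ∑_{i=1}^k (-1)^{(i-1)(l-1)} φ(a_1, …, a_{i-1}, ψ(a_i, …, a_{i+l-1}), …)`;
here `s = i - 1`. -/
def preLie {k l : ℕ} (φ : Cochain k B B) (ψ : Cochain l B B) : Cochain (k + l - 1) B B :=
  ∑ s : Fin k, Int.negOnePow ((s : ℤ) * ((l : ℤ) - 1)) • insertAt φ ψ s

end PreLie

/-! ## Polynomial multivector fields -/

/-- The exterior algebra of the complexified tangent space of `V`, with basis `∂_i = ∂/∂x^i`. -/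
abbrev Ext (n : ℕ) : Type := ExteriorAlgebra ℂ (Fin n → ℂ)

/-- `∂_{i_1} ∧ … ∧ ∂_{i_m}` for a list of indices. -/
def wedge {n : ℕ} (L : List (Fin n)) : Ext n :=
  (L.map fun i => ExteriorAlgebra.ι ℂ (Pi.single i (1 : ℂ))).prod

/-- The linear form on the exterior algebra that is zero except in degree `t.length`, where it is
`v_1 ∧ … ∧ v_N ↦ det (x^{t_b}(v_a))`; so it reads off the coefficient of
`∂_{t_1} ∧ … ∧ ∂_{t_N}`, for a list `t` without repetition. -/
def extCoeff {n : ℕ} (t : List (Fin n)) : Ext n →ₗ[ℂ] ℂ :=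
  ExteriorAlgebra.liftAlternating
    (Pi.single t.length
      (Matrix.detRowAlternating.compLinearMap (LinearMap.funLeft ℂ ℂ t.get)))

/-- Coefficient of `∂_{t_1} ∧ … ∧ ∂_{t_N}` in a multivector field with coefficients in `S`. -/
def mcoeff {n : ℕ} {S : Type*} [CommRing S] [Algebra ℂ S] (t : List (Fin n)) :
    S ⊗[ℂ] Ext n →ₗ[ℂ] S :=
  (TensorProduct.rid ℂ S).toLinearMap ∘ₗ LinearMap.lTensor S (extCoeff t)

section Sections

variable {G : Type*} [CommGroup G] {n : ℕ} (χ : Fin n → G →* ℂˣ)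

/-- Polynomial functions on `V^g`. -/
abbrev PolyFix (g : G) : Type := MvPolynomial {i // i ∈ tang χ g} ℂ

open Classical in
/-- Restriction of functions from `V` to `V^g`. -/
def restrictFn (g : G) : Poly n →ₐ[ℂ] PolyFix χ g :=
  aeval fun i => if h : i ∈ tang χ g then X ⟨i, h⟩ else 0

/-- Extension of functions from `V^g` to `V = V^g ⊕ N^g`, constant along `N^g`. -/
def extendFn (g : G) : PolyFix χ g →ₐ[ℂ] Poly n := rename Subtype.val

/-- Polynomial sections over `V^g` of `∧^• TV|_{V^g}`. -/
abbrev MVFix (g : G) : Type := PolyFix χ g ⊗[ℂ] Ext n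

/-- `Λ_g = ∂/∂y^1 ∧ … ∧ ∂/∂y^{l(g)}`. -/
def Lam (g : G) : Ext n := wedge (normal χ g).sort

/-- `Γ(∧^{k-l(g)} TV^g ⊗ ∧^{l(g)} N^g)`, spanned by the `p ∂_I ∧ Λ_g`, where `p` is a polynomial
function on `V^g` and `I` is a set of `k - l(g)` coordinates on `V^g`. It is zero if `k < l(g)`. -/
def Sec (g : G) (k : ℕ) : Submodule ℂ (MVFix χ g) :=
  Submodule.span ℂ {ω | ∃ (I : Finset (Fin n)) (p : PolyFix χ g), I ⊆ tang χ g ∧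
    I.card + codim χ g = k ∧ ω = p ⊗ₜ[ℂ] (wedge I.sort * Lam χ g)}

theorem tmul_mem_Sec (g : G) (k : ℕ) (p : PolyFix χ g) (I : Finset (Fin n)) (h : I ⊆ tang χ g)
    (hk : I.card + codim χ g = k) : p ⊗ₜ[ℂ] (wedge I.sort * Lam χ g) ∈ Sec χ g k := by
  unfold Sec
  apply Submodule.subset_span
  rw [Set.mem_ofPred_eq]
  exact ⟨I, p, h, hk, rfl⟩

/-- The section `p ∂_I ∧ Λ_g`. -/
def secTerm (g : G) (k : ℕ) (p : PolyFix χ g) (I : Finset (Fin n))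
    (h : I ⊆ tang χ g ∧ I.card + codim χ g = k) : Sec χ g k :=
  ⟨_, tmul_mem_Sec χ g k p I h.1 h.2⟩

/-- The coefficient `X^{t_1 … t_m}` of `ξ = X ⊗ Λ_g`, where
`X = ∑_{t_1 < … < t_m} X^{t_1 … t_m} ∂_{t_1} ∧ … ∧ ∂_{t_m}`; antisymmetric in `t_1, …, t_m`. -/
def coeffX (g : G) (t : List (Fin n)) (ξ : MVFix χ g) : PolyFix χ g :=
  mcoeff (t ++ (normal χ g).sort) ξ

/-- Push-forward of multivector fields along `V^g` by `h`: `(h_* ξ)(v) = h (ξ (h⁻¹ v))`. On tangent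
vectors `h` multiplies `∂_i` by `χ i h⁻¹`. -/
def push (g h : G) : MVFix χ g →ₗ[ℂ] MVFix χ g :=
  TensorProduct.map
    (aeval fun i : {i // i ∈ tang χ g} => C (χ i.1 h : ℂ) * X i : PolyFix χ g →ₐ[ℂ] _).toLinearMap
    (ExteriorAlgebra.map (LinearMap.pi fun i =>
      ((χ i h⁻¹ : ℂˣ) : ℂ) • LinearMap.proj i)).toLinearMap

/-- `ξ = ∑_g ξ_g` is `G`-invariant (conjugation is trivial, as `G` is abelian). -/
def IsGInvariant {k : ℕ} (ξ : ∀ g, Sec χ g k) : Prop :=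
  ∀ g h : G, push χ g h (ξ g) = ξ g

/-! ## The twisted cocycles and the map `T` -/

/-- Substitution `y^i ↦ ỹ^i = g(y^i)` for the coordinates with index in `S` only. -/
def partialTwist (g : G) (S : Finset (Fin n)) : Poly n →ₐ[ℂ] Poly n :=
  aeval fun i => if i ∈ S then C (χ i g : ℂ) * X i else X i

/-- `f ↦ (f(z) - f(z')) / (y^i - ỹ^i)`, where in `z` the coordinates in `S`, and in `z'` those in
`S ∪ {i}`, are replaced by their transforms (see `dividedDiff_spec`). -/
def dividedDiff (g : G) (S : Finset (Fin n)) (i : Fin n) : Poly n →ₗ[ℂ] Poly n where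
  toFun f := C (1 - (χ i g : ℂ))⁻¹ *
    (partialTwist χ g S f - partialTwist χ g (insert i S) f).divMonomial (Finsupp.single i 1)
  map_add' f f' := by
    rw [← mul_add, ← add_divMonomial]; congr 2; simp only [map_add]; ring
  map_smul' c f := by
    ext m
    simp only [map_smul, ← smul_sub, coeff_C_mul, coeff_divMonomial, coeff_smul, smul_eq_mul,
      RingHom.id_apply]
    ring

theorem dividedDiff_spec (g : G) (S : Finset (Fin n)) (i : Fin n) (hi : i ∈ normal χ g) (f : Poly n) :
    dividedDiff χ g S i f * (X i - act χ g (X i)) =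
      partialTwist χ g S f - partialTwist χ g (insert i S) f := by
  have hc : (1 : ℂ) - (χ i g : ℂ) ≠ 0 := by
    intro h
    have h1 : χ i g = 1 := Units.ext (by simpa using (sub_eq_zero.mp h).symm)
    simp [normal] at hi
    exact hi h1
  have hd : (X i : Poly n) ∣ partialTwist χ g S f - partialTwist χ g (insert i S) f := by
    induction f using MvPolynomial.induction_on with
    | C a => simp
    | add p q hp hq =>
      rw [map_add, map_add, add_sub_add_comm]; exact dvd_add hp hq
    | mul_X p j hp =>
      rw [map_mul, map_mul]
      have hj : (X i : Poly n) ∣ partialTwist χ g S (X j) - partialTwist χ g (insert i S) (X j) := by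
        by_cases hij : j = i
        · subst hij
          simp only [partialTwist, aeval_X]
          split_ifs <;> exact dvd_sub (by simp) (by simp)
        · simp [partialTwist, hij]
      have e : partialTwist χ g S p * partialTwist χ g S (X j) -
          partialTwist χ g (insert i S) p * partialTwist χ g (insert i S) (X j) =
          (partialTwist χ g S p - partialTwist χ g (insert i S) p) * partialTwist χ g S (X j) +
          partialTwist χ g (insert i S) p *
            (partialTwist χ g S (X j) - partialTwist χ g (insert i S) (X j)) := by ring
      rw [e]
      exact dvd_add (hp.mul_right _) (hj.mul_left _)
  obtain ⟨q, hq⟩ := hd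
  have h1 : (C (1 - (χ i g : ℂ))⁻¹ : Poly n) * (1 - C (χ i g : ℂ)) = 1 := by
    rw [← C_1, ← C_sub, ← C_mul, inv_mul_cancel₀ hc]
  change C (1 - (χ i g : ℂ))⁻¹ * (partialTwist χ g S f -
    partialTwist χ g (insert i S) f).divMonomial (Finsupp.single i 1) * _ = _
  rw [hq, X_mul_divMonomial]
  simp only [act, aeval_X]
  linear_combination (q * X i) * h1

/-- The `g`-twisted cocycle `Ω_g`: the average over `σ`, with signs, of
`∏_r (f_r(z_σ^{r-1}) - f_r(z_σ^r)) / (y^{σ(r)} - ỹ^{σ(r)})`, where `z_σ^r` arises from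
`(x, y)` by replacing `y^{σ(1)}, …, y^{σ(r)}` by `ỹ^{σ(1)}, …, ỹ^{σ(r)}`. -/
def Omega (g : G) : Cochain (codim χ g) (Poly n) (Poly n) :=
  ((codim χ g).factorial : ℂ)⁻¹ • ∑ σ : Equiv.Perm (Fin (codim χ g)), (Equiv.Perm.sign σ) •
    (MultilinearMap.mkPiAlgebra ℂ (Fin (codim χ g)) (Poly n)).compLinearMap fun r =>
      dividedDiff χ g ((Finset.Iio r).image fun s => yIdx χ g (σ s)) (yIdx χ g (σ r))

/-- `(f_1, …, f_k) ↦ φ(f_1, …, f_m) ψ(f_{m+1}, …, f_k)`, where `m + p = k`. -/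
def sharp {m p k : ℕ} (h : m + p = k) (φ : Cochain m (Poly n) (Poly n))
    (ψ : Cochain p (Poly n) (Poly n)) : Cochain k (Poly n) (Poly n) :=
  ((LinearMap.mul' ℂ (Poly n)).compMultilinearMap (φ.domCoprod ψ)).domDomCongr
    (finSumFinEquiv.trans (finCongr h))

/-- `(f_1, …, f_m) ↦ ∂_{t_1} f_1 ⋯ ∂_{t_m} f_m`. -/
def derivs {m : ℕ} (t : Fin m → Fin n) : Cochain m (Poly n) (Poly n) :=
  (MultilinearMap.mkPiAlgebra ℂ (Fin m) (Poly n)).compLinearMap fun r =>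
    (pderiv (R := ℂ) (t r)).toLinearMap

/-- `T_1^g (X ⊗ Λ_g) = X ♯ Ω_g`. The multivector field `X`, of degree `m = k - l(g)`, acts as the
multidifferential operator `(1/m!) ∑_{t_1, …, t_m} X^{t_1 … t_m} ∂_{t_1} ⊗ … ⊗ ∂_{t_m}`, i.e.
`∂_{i_1} ∧ … ∧ ∂_{i_m}` is the signed average of the `∂_{i_σ(1)} ⊗ … ⊗ ∂_{i_σ(m)}`. -/
def T1g (g : G) (k : ℕ) (ξ : MVFix χ g) : Cochain k (Poly n) (Poly n) :=
  if h : codim χ g ≤ k then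
    ((k - codim χ g).factorial : ℂ)⁻¹ • ∑ t : Fin (k - codim χ g) → {i // i ∈ tang χ g},
      (LinearMap.mulLeft ℂ (extendFn χ g (coeffX χ g (List.ofFn fun r => (t r).1) ξ))).compMultilinearMap
        (sharp (Nat.sub_add_cancel h) (derivs fun r => (t r).1) (Omega χ g))
  else 0

variable [Fintype G]

/-- `T_1 ξ = ∑_g T_1^g(ξ_g) U_g`, a cochain on `Poly(V)` with values in `Poly(V) ⋊ G`. -/
def T1 {k : ℕ} (ξ : ∀ g, Sec χ g k) : Cochain k (Poly n) (Crossed G n) :=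
  ∑ g : G, (SkewMonoidAlgebra.lsingle ℂ g).compMultilinearMap (T1g χ g k (ξ g))

/-- `T_2(Φ)(a_1 U_{g_1}, …, a_k U_{g_k})
  = Φ(a_1, g_1(a_2), …, g_1 ⋯ g_{k-1}(a_k)) U_{g_1 ⋯ g_k}`. -/
def T2 {k : ℕ} (Φ : Cochain k (Poly n) (Crossed G n)) : Cochain k (Crossed G n) (Crossed G n) :=
  ∑ γ : Fin k → G, (mulU χ (∏ r, γ r)).compMultilinearMap
    (Φ.compLinearMap fun r =>
      (act χ (∏ s ∈ Finset.Iio r, γ s)).toLinearMap ∘ₗ coeffAt (γ r))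

/-- `T = T_2 ∘ T_1`. -/
def T {k : ℕ} (ξ : ∀ g, Sec χ g k) : Cochain k (Crossed G n) (Crossed G n) := T2 χ (T1 χ ξ)

/-! ## The map `L` -/

/-- `L_1(Ψ)(f_1, …, f_N) = |G|⁻¹ ∑_g U_{g⁻¹} Ψ(g(f_1), …, g(f_N)) U_g`. -/
def L1 {N : ℕ} (Ψ : Cochain N (Crossed G n) (Crossed G n)) : Cochain N (Poly n) (Crossed G n) :=
  (Fintype.card G : ℂ)⁻¹ • ∑ g : G, (conjU χ g).compMultilinearMap
    (Ψ.compLinearMap fun _ => SkewMonoidAlgebra.lsingle ℂ (1 : G) ∘ₗ (act χ g).toLinearMap)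

/-- The polynomial `p ↦ Ψ(x^{j_1} - p^{j_1}, …, x^{j_N} - p^{j_N})(p)` (see `eval_atPoint`),
obtained by expanding the arguments. -/
def atPoint {N : ℕ} (Ψ : Cochain N (Poly n) (Poly n)) (j : Fin N → Fin n) : Poly n :=
  ∑ S : Finset (Fin N), (∏ s ∈ S, -X (j s)) * Ψ fun s => if s ∈ S then 1 else X (j s)

theorem eval_atPoint {N : ℕ} (Ψ : Cochain N (Poly n) (Poly n)) (j : Fin N → Fin n)
    (p : Fin n → ℂ) :
    eval p (atPoint Ψ j) = eval p (Ψ fun s => X (j s) - C (p (j s))) := by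
  have h : (fun s => X (j s) - C (p (j s)) : Fin N → Poly n) =
      (fun s => (-p (j s)) • (1 : Poly n)) + fun s => X (j s) := by
    funext s; simp [MvPolynomial.smul_eq_C_mul]; ring
  rw [h, MultilinearMap.map_add_univ, atPoint, map_sum, map_sum]
  refine Finset.sum_congr rfl fun S _ => ?_
  have h2 : (S.piecewise (fun s => (-p (j s)) • (1 : Poly n)) fun s => X (j s)) =
      S.piecewise (fun s => (-p (j s)) • (if s ∈ S then 1 else X (j s) : Poly n))
        fun s => if s ∈ S then 1 else X (j s) := by
    funext s; by_cases hs : s ∈ S <;> simp [hs]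
  rw [h2, MultilinearMap.map_piecewise_smul]
  simp [MvPolynomial.smul_eval]

/-- `L_2^g(Ψ)(p) = ∑_{i_1, …, i_N} (1/N!) ∑_σ (-1)^σ
  Ψ((x_{σ(1)} - p)^{i_1} ⋯ (x_{σ(N)} - p)^{i_N})(p) ∂_{i_1} ∧ … ∧ ∂_{i_N}`, where the function
`x^{i_a} - p^{i_a}` is put in the slot `σ(a)` of `Ψ`. -/
def L2 {N : ℕ} (Ψ : Cochain N (Poly n) (Poly n)) : Poly n ⊗[ℂ] Ext n :=
  ∑ i : Fin N → Fin n, ((N.factorial : ℂ)⁻¹ • ∑ σ : Equiv.Perm (Fin N),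
    (Equiv.Perm.sign σ) • atPoint Ψ fun s => i (σ.symm s)) ⊗ₜ[ℂ] wedge (List.ofFn i)

/-- `L_3^g(ω) = pr^g(ω|_{V^g})`: restriction to `V^g`, and projection from `∧^N (TV^g ⊕ N^g)` onto
its summand `∧^{N-l(g)} TV^g ⊗ ∧^{l(g)} N^g`. -/
def L3 (g : G) (N : ℕ) (ω : Poly n ⊗[ℂ] Ext n) : Sec χ g N :=
  ∑ I : {I : Finset (Fin n) // I ⊆ tang χ g ∧ I.card + codim χ g = N},
    secTerm χ g N (restrictFn χ g (mcoeff (I.1.sort ++ (normal χ g).sort) ω)) I.1 I.2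

/-- The `g`-component of `L = L_3 ∘ L_2 ∘ L_1`. -/
def L {N : ℕ} (Ψ : Cochain N (Crossed G n) (Crossed G n)) (g : G) : Sec χ g N :=
  L3 χ g N (L2 ((coeffAt g).compMultilinearMap (L1 χ Ψ)))

/-! ## The terms of the formula

For `X` on `V^λ`, `Y` on `V^μ` and `g = λ μ`; the vector fields `∂_i` with `i ∈ tang χ g` are those
along `V^g`. -/

/-- The first sum, over `I = {i_1 < … < i_m}` with `m = k - l(λ)`, `J = {j_1 < … < j_p}` with
`p = l - l(μ)`, both indexing coordinates on `V^g`, and over `z = 1, …, m` (here `z` starts at `0`):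
`(-1)^{(z-1)(l-1) + (k-z) l + (l-l(μ)) l(λ)} X^{i_1 … i_m} (∂Y^{j_1 … j_p} / ∂x^{i_z})
  ∂_{i_1} ∧ … (omit ∂_{i_z}) … ∧ ∂_{i_m} ∧ ∂_{j_1} ∧ … ∧ ∂_{j_p} ∧ Λ_λ ∧ Λ_μ`. -/
def tangentialTerm (g lam mu : G) (k l : ℕ) (ξ : MVFix χ lam) (η : MVFix χ mu) : MVFix χ g :=
  ∑ I ∈ (tang χ g).powersetCard (k - codim χ lam),
  ∑ J ∈ (tang χ g).powersetCard (l - codim χ mu),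
  ∑ z : Fin I.sort.length,
    Int.negOnePow ((z : ℤ) * ((l : ℤ) - 1) + ((k : ℤ) - (z + 1)) * l
        + ((l : ℤ) - codim χ mu) * codim χ lam) •
      (restrictFn χ g (extendFn χ lam (coeffX χ lam I.sort ξ) *
          pderiv (I.sort.get z) (extendFn χ mu (coeffX χ mu J.sort η)))
        ⊗ₜ[ℂ] (wedge (I.sort.eraseIdx z) * wedge J.sort * Lam χ lam * Lam χ mu))

/-- The second sum, over `I = {i_1 < … < i_m}` with `m = k - l(λ)`, `J = {j_1 < … < j_{p-1}}` with
`p = l - l(μ)`, both indexing coordinates on `V^g`, and over the indices `q` of the coordinates on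
`N^λ`:
`(-1)^{(k-l(λ))(l-1) + l(μ)(l(λ)-1)} X^{i_1 … i_m} (∂Y^{j_1 … j_{p-1} q} / ∂x^q)
  ∂_{i_1} ∧ … ∧ ∂_{i_m} ∧ ∂_{j_1} ∧ … ∧ ∂_{j_{p-1}} ∧ Λ_λ ∧ Λ_μ`;
it is zero if `p = 0`, since then no coefficient of `Y` has an index. -/
def normalTerm (g lam mu : G) (k l : ℕ) (ξ : MVFix χ lam) (η : MVFix χ mu) : MVFix χ g :=
  if codim χ mu < l then
    ∑ I ∈ (tang χ g).powersetCard (k - codim χ lam),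
    ∑ J ∈ (tang χ g).powersetCard (l - codim χ mu - 1),
    ∑ q ∈ normal χ lam,
      Int.negOnePow (((k : ℤ) - codim χ lam) * ((l : ℤ) - 1)
          + (codim χ mu : ℤ) * ((codim χ lam : ℤ) - 1)) •
        (restrictFn χ g (extendFn χ lam (coeffX χ lam I.sort ξ) *
            pderiv q (extendFn χ mu (coeffX χ mu (J.sort ++ [q]) η)))
          ⊗ₜ[ℂ] (wedge I.sort * wedge J.sort * Lam χ lam * Lam χ mu))
  else 0

end Sections

end
end OrbifoldBracket

open OrbifoldBracket

/-!
The proof computes symbols. For a normalized cochain `Ψ` on polynomials (one that vanishes when an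
argument is constant), `L_2 Ψ = ∑_j Ψ(x^{j_1}, …, x^{j_N}) ⊗ ∂_{j_1} ∧ … ∧ ∂_{j_N}`; this is its
symbol, and `L` restricts the symbol of each component to `V^g` and projects it. Invariance of `ξ`
and `η` makes the average over `G` in `L` trivial (`coeffAt_L1_preLie`).

Each `T_1^g ξ` is a combination of products `∏_r D_r(f_r)`, where every `D_r` is a partial derivative
or a divided difference along some coordinate `x^{w_r}`, so that `D_r(x^i)` is `1` for `i = w_r` and
`0` otherwise. Its symbol is `ξ` (`sum_slotCoeff_tmul_wedge`). Inserting `T_1^μ η` in slot `s` of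
`∏_r D_r` therefore has as symbol the monomial of `w` with `∂_{w_s}` removed, wedged with `D_s` applied
to the coefficients of `η` (`sum_insertion`). The element `μ` acts on the arguments behind the
inserted block and so multiplies their coordinate functions by characters, but these factors are
absorbed by `Λ_μ` (`prod_smul_map_sandwich`).

If `λ` and `μ` move a common coordinate `x^i`, every term vanishes: either `∂_i` survives in the
monomial and occurs in `Λ_μ` too, or `D_s` differentiates along `x^i` a coefficient of `η`, which does
not depend on `x^i` (`mul_rTensor_slotOp_eq_zero`). Otherwise all coordinates moved by `λ` vanish on
`V^{λμ}`, and there divided differences restrict to partial derivatives (`restrictFn_dividedDiff`). So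
the symbol of the alternating sum of the insertions becomes `(-1)^{l(k-1)}` times the bracket
`∑_q (ι_{dx^q} ξ) ∧ ∂_q η` (`restrictMV_insertionSymbol`). Its projection is the sum of two parts:
contraction of `X` gives the first sum of the formula (`tangentialTerm_basis`). Contraction of `Λ_λ`
by `dx^q` survives the projection only if `Y` supplies `∂_q` again, and gives the second
(`normalTerm_basis`).

Codimensions satisfy `l(λμ) = l(λ) + l(μ)` exactly if no coordinate is moved by both `λ` and `μ`, that
is if `(λ - 1) (μ - 1) = 0`, or `V^λ + V^μ = V`. This gives the decomposition of `V`, and the vanishing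
statement follows from the formula, all of whose pairs satisfy the condition.
-/

namespace OrbifoldBracket

noncomputable section

/-! ### Wedge monomials -/

section Wedge

variable {n : ℕ}

@[simp] theorem wedge_nil : wedge ([] : List (Fin n)) = 1 := rfl

theorem wedge_cons (i : Fin n) (L : List (Fin n)) :
    wedge (i :: L) = ExteriorAlgebra.ι ℂ (Pi.single i (1 : ℂ)) * wedge L := by
  simp [wedge]

theorem wedge_append (L L' : List (Fin n)) : wedge (L ++ L') = wedge L * wedge L' := by
  simp [wedge]

theorem wedge_singleton (i : Fin n) :
    wedge [i] = ExteriorAlgebra.ι ℂ (Pi.single i (1 : ℂ)) := by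
  simp [wedge]

theorem wedge_ofFn {N : ℕ} (w : Fin N → Fin n) :
    wedge (List.ofFn w) = ExteriorAlgebra.ιMulti ℂ N fun a => Pi.single (w a) (1 : ℂ) := by
  rw [ExteriorAlgebra.ιMulti_apply, wedge, List.map_ofFn]; rfl

theorem wedge_ofFn_perm {N : ℕ} (w : Fin N → Fin n) (σ : Equiv.Perm (Fin N)) :
    wedge (List.ofFn fun a => w (σ a)) = Equiv.Perm.sign σ • wedge (List.ofFn w) := by
  rw [wedge_ofFn, wedge_ofFn]
  exact AlternatingMap.map_perm _ (fun a => (Pi.single (w a) (1 : ℂ) : Fin n → ℂ)) σ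

theorem wedge_eq_zero_of_not_nodup {L : List (Fin n)} (h : ¬ L.Nodup) : wedge L = 0 := by
  rw [List.nodup_iff_injective_get, Function.Injective] at h
  push Not at h
  obtain ⟨a, b, hab, hne⟩ := h
  rw [← List.ofFn_get L, wedge_ofFn]
  exact AlternatingMap.map_eq_zero_of_eq _ _ (by rw [hab]) hne

theorem wedge_mul_eq_zero {L L' : List (Fin n)} {i : Fin n} (h : i ∈ L) (h' : i ∈ L') :
    wedge L * wedge L' = 0 := by
  rw [← wedge_append]
  refine wedge_eq_zero_of_not_nodup fun hn => ?_
  exact (List.disjoint_of_nodup_append hn) h h'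

theorem wedge_swap_cons (i j : Fin n) (L : List (Fin n)) :
    wedge (i :: j :: L) = - wedge (j :: i :: L) := by
  rw [wedge_cons, wedge_cons, wedge_cons, wedge_cons, ← mul_assoc, ← mul_assoc, ← neg_mul]
  congr 1
  exact eq_neg_of_add_eq_zero_left (ExteriorAlgebra.ι_add_mul_swap _ _)

theorem wedge_perm {L L' : List (Fin n)} (h : L.Perm L') :
    ∃ ε : ℤˣ, wedge L = ε • wedge L' := by
  induction h with
  | nil => exact ⟨1, by simp⟩
  | cons i _ ih =>
    obtain ⟨ε, h⟩ := ih
    exact ⟨ε, by rw [wedge_cons, h, wedge_cons, mul_smul_comm]⟩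
  | swap i j L => exact ⟨-1, by rw [wedge_swap_cons]; simp [Units.smul_def]⟩
  | trans _ _ ih ih' =>
    obtain ⟨ε, h⟩ := ih
    obtain ⟨ε', h'⟩ := ih'
    exact ⟨ε * ε', by rw [h, h', mul_smul]⟩

theorem wedge_mul_comm (L L' : List (Fin n)) :
    wedge L * wedge L' = (-1 : ℂ) ^ (L.length * L'.length) • (wedge L' * wedge L) := by
  -- one vector is moved past a list, and then the list `L` vector by vector
  have h1 : ∀ (i : Fin n) (L' : List (Fin n)),
      wedge (i :: L') = (-1 : ℂ) ^ L'.length • (wedge L' * wedge [i]) := by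
    intro i L'
    induction L' with
    | nil => simp
    | cons j L' ih =>
      rw [wedge_swap_cons, wedge_cons, ih, wedge_cons j L', List.length_cons, pow_succ,
        mul_smul_comm, mul_assoc, mul_neg_one, neg_smul]
  induction L with
  | nil => simp
  | cons i L ih =>
    rw [wedge_cons, mul_assoc, ih, mul_smul_comm, ← mul_assoc, ← wedge_cons, h1, smul_mul_assoc,
      smul_smul, mul_assoc, wedge_singleton, ← pow_add, List.length_cons]
    congr 2; ring

/-! ### Coefficients of wedge monomials -/

theorem extCoeff_wedge_of_length_ne {t L : List (Fin n)} (h : L.length ≠ t.length) :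
    extCoeff t (wedge L) = 0 := by
  have : wedge L = ExteriorAlgebra.ιMulti ℂ L.length fun a => Pi.single (L.get a) (1 : ℂ) := by
    rw [← wedge_ofFn, List.ofFn_get]
  rw [this, extCoeff, ExteriorAlgebra.liftAlternating_apply_ιMulti, Pi.single_eq_of_ne h]
  rfl

theorem extCoeff_wedge_ofFn (t : List (Fin n)) (w : Fin t.length → Fin n) :
    extCoeff t (wedge (List.ofFn w)) =
      (Matrix.of fun a b => (Pi.single (w a) (1 : ℂ) : Fin n → ℂ) (t.get b)).det := by
  rw [wedge_ofFn, extCoeff, ExteriorAlgebra.liftAlternating_apply_ιMulti, Pi.single_eq_same]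
  rfl

theorem extCoeff_wedge_self {t : List (Fin n)} (h : t.Nodup) : extCoeff t (wedge t) = 1 := by
  have := extCoeff_wedge_ofFn t t.get
  rw [List.ofFn_get] at this
  rw [this, ← Matrix.det_one (n := Fin t.length)]
  congr 1
  ext a b
  by_cases hab : a = b
  · subst hab; simp
  · have : t.get b ≠ t.get a := fun h' => hab ((List.nodup_iff_injective_get.mp h) h').symm
    rw [Matrix.of_apply, Pi.single_eq_of_ne this, Matrix.one_apply_ne hab]

theorem extCoeff_wedge_of_notMem {t L : List (Fin n)} {i : Fin n} (h : i ∈ t) (h' : i ∉ L) :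
    extCoeff t (wedge L) = 0 := by
  by_cases hl : L.length = t.length
  · obtain ⟨w, rfl⟩ : ∃ w : Fin t.length → Fin n, L = List.ofFn w := by
      rw [← hl]; exact ⟨L.get, (List.ofFn_get L).symm⟩
    rw [extCoeff_wedge_ofFn]
    obtain ⟨b, rfl⟩ := List.get_of_mem h
    refine Matrix.det_eq_zero_of_column_eq_zero b fun a => ?_
    rw [Matrix.of_apply, Pi.single_eq_of_ne]
    intro h2
    exact h' (by rw [h2]; simp [List.mem_ofFn])
  · exact extCoeff_wedge_of_length_ne hl

theorem perm_of_extCoeff_wedge_ne_zero {t L : List (Fin n)} (ht : t.Nodup)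
    (h : extCoeff t (wedge L) ≠ 0) : t.Perm L := by
  have hlen : L.length = t.length := by
    by_contra hl; exact h (extCoeff_wedge_of_length_ne hl)
  have hsub : t ⊆ L := fun i hi => by
    by_contra hi'; exact h (extCoeff_wedge_of_notMem hi hi')
  exact (List.subperm_of_subset ht hsub).perm_of_length_le hlen.le

theorem extCoeff_eq_zero_of_not_nodup {t : List (Fin n)} (h : ¬ t.Nodup) (L : List (Fin n)) :
    extCoeff t (wedge L) = 0 := by
  by_cases hl : L.length = t.length
  · obtain ⟨w, rfl⟩ : ∃ w : Fin t.length → Fin n, L = List.ofFn w := by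
      rw [← hl]; exact ⟨L.get, (List.ofFn_get L).symm⟩
    rw [List.nodup_iff_injective_get, Function.Injective] at h
    push Not at h
    obtain ⟨a, b, hab, hne⟩ := h
    rw [extCoeff_wedge_ofFn]
    exact Matrix.det_zero_of_column_eq hne fun k => by rw [Matrix.of_apply, Matrix.of_apply, hab]
  · exact extCoeff_wedge_of_length_ne hl

/-- A permutation of a monomial changes its coefficient and the monomial by the same sign. -/
theorem extCoeff_smul_wedge_perm {t L : List (Fin n)} (ht : t.Nodup) (h : t.Perm L) :
    extCoeff t (wedge L) • wedge t = wedge L := by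
  obtain ⟨ε, hε⟩ := wedge_perm h.symm
  have h2 : ∀ ε : ℤˣ, ∀ x : Ext n, ε • x = ((ε : ℤ) : ℂ) • x := fun ε x => by
    rw [Units.smul_def, Int.cast_smul_eq_zsmul]
  rw [hε, h2, map_smul, extCoeff_wedge_self ht, smul_eq_mul, mul_one]

/-! ### Contractions -/

/-- Contraction of a multivector with the covector `dx^q`. -/
def contr (q : Fin n) : Ext n →ₗ[ℂ] Ext n :=
  CliffordAlgebra.contractLeft (Q := (0 : QuadraticForm ℂ (Fin n → ℂ))) (LinearMap.proj q)

theorem contr_one (q : Fin n) : contr q (1 : Ext n) = 0 := CliffordAlgebra.contractLeft_one _ _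

theorem contr_wedge_cons (q i : Fin n) (L : List (Fin n)) :
    contr q (wedge (i :: L)) =
      (if i = q then (1 : ℂ) else 0) • wedge L - wedge [i] * contr q (wedge L) := by
  rw [wedge_cons, contr, wedge_singleton]
  refine (CliffordAlgebra.contractLeft_ι_mul _ _ _).trans ?_
  congr 2
  simp [Pi.single_apply, eq_comm]

theorem contr_wedge (q : Fin n) (L : List (Fin n)) :
    contr q (wedge L) = ∑ z : Fin L.length,
      (if L.get z = q then (-1 : ℂ) ^ (z : ℕ) else 0) • wedge (L.eraseIdx z) := by
  induction L with
  | nil => simp [contr_one]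
  | cons i L ih =>
    rw [contr_wedge_cons, ih]
    simp only [List.length_cons]
    rw [Fin.sum_univ_succ, sub_eq_add_neg]
    congr 1
    rw [Finset.mul_sum, ← Finset.sum_neg_distrib]
    refine Finset.sum_congr rfl fun z _ => ?_
    have : wedge (i :: L.eraseIdx z) = wedge [i] * wedge (L.eraseIdx z) := by
      rw [← wedge_append]; rfl
    simp only [List.get_eq_getElem, Fin.val_succ, List.getElem_cons_succ, List.eraseIdx_cons_succ,
      this, mul_smul_comm]
    split_ifs
    · rw [pow_succ, mul_neg_one, neg_smul]
    · simp

theorem contr_wedge_append (q : Fin n) (L L' : List (Fin n)) :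
    contr q (wedge L * wedge L') = contr q (wedge L) * wedge L' +
      (-1 : ℂ) ^ L.length • (wedge L * contr q (wedge L')) := by
  induction L with
  | nil => simp [contr_one]
  | cons i L ih =>
    have h : ∀ K : List (Fin n), wedge (i :: K) = wedge [i] * wedge K := fun K => by
      rw [← wedge_append]; rfl
    rw [← wedge_append, List.cons_append, contr_wedge_cons, contr_wedge_cons, wedge_append, ih, h L,
      List.length_cons, pow_succ]
    simp only [mul_add, sub_mul, mul_smul_comm, smul_mul_assoc, mul_assoc, mul_neg_one, neg_smul]
    abel

theorem contr_wedge_eq_zero {q : Fin n} {L : List (Fin n)} (h : q ∉ L) :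
    contr q (wedge L) = 0 := by
  rw [contr_wedge]
  refine Finset.sum_eq_zero fun z _ => ?_
  rw [if_neg, zero_smul]
  rintro rfl
  exact h (List.get_mem _ _)

end Wedge

/-! ### The projection onto sections over a fixed space -/

section Projection

variable {G : Type*} [CommGroup G] {n : ℕ} (χ : Fin n → G →* ℂˣ)

theorem mem_tang {g : G} {i : Fin n} : i ∈ tang χ g ↔ χ i g = 1 := by simp [tang]

theorem mem_normal {g : G} {i : Fin n} : i ∈ normal χ g ↔ χ i g ≠ 1 := by simp [normal]

theorem mem_tang_iff_notMem_normal {g : G} {i : Fin n} : i ∈ tang χ g ↔ i ∉ normal χ g := by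
  rw [mem_tang, mem_normal, not_not]

theorem Lam_eq (g : G) : Lam χ g = wedge (normal χ g).sort := rfl

theorem length_sort_normal (g : G) : (normal χ g).sort.length = codim χ g := Finset.length_sort _

theorem nodup_sort_append_normal {g : G} {I : Finset (Fin n)} (hI : I ⊆ tang χ g) :
    (I.sort ++ (normal χ g).sort).Nodup := by
  refine List.nodup_append.mpr ⟨Finset.sort_nodup _ _, Finset.sort_nodup _ _, ?_⟩
  rintro a ha b hb rfl
  rw [Finset.mem_sort] at ha hb
  exact (mem_tang_iff_notMem_normal χ).mp (hI ha) hb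

/-- The projection of multivectors of degree `N` onto `∧^{N-l(g)} TV^g ⊗ ∧^{l(g)} N^g`. -/
def projSec (g : G) (N : ℕ) : Ext n →ₗ[ℂ] Ext n :=
  ∑ I : {I : Finset (Fin n) // I ⊆ tang χ g ∧ I.card + codim χ g = N},
    (extCoeff (I.1.sort ++ (normal χ g).sort)).smulRight (wedge I.1.sort * Lam χ g)

/-- `L_3` is the tensor product of restriction to `V^g` and the projection of multivectors. -/
theorem coe_L3 (g : G) (N : ℕ) (ω : Poly n ⊗[ℂ] Ext n) :
    (L3 χ g N ω : MVFix χ g) =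
      TensorProduct.map (restrictFn χ g).toLinearMap (projSec χ g N) ω := by
  induction ω using TensorProduct.induction_on with
  | zero => simp [L3, secTerm]
  | tmul a e =>
    simp only [L3, secTerm, AddSubmonoidClass.coe_finsetSum, mcoeff, LinearMap.comp_apply,
      LinearMap.lTensor_tmul, TensorProduct.map_tmul, projSec, LinearMap.sum_apply,
      TensorProduct.tmul_sum, LinearMap.smulRight_apply, TensorProduct.tmul_smul]
    refine Finset.sum_congr rfl fun I _ => ?_
    simp [TensorProduct.smul_tmul']
  | add a b ha hb =>
    rw [map_add, ← ha, ← hb, ← Submodule.coe_add]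
    congr 1
    simp only [L3, map_add]
    rw [← Finset.sum_add_distrib]
    refine Finset.sum_congr rfl fun I _ => ?_
    ext1
    simp [secTerm, TensorProduct.add_tmul]

theorem projSec_wedge_of_forall_mem {g : G} {N : ℕ} {L : List (Fin n)} (hN : L.length = N)
    (h : ∀ i ∈ normal χ g, i ∈ L) : projSec χ g N (wedge L) = wedge L := by
  subst hN
  by_cases hL : L.Nodup
  · have hnorm : normal χ g ⊆ L.toFinset := fun i hi => List.mem_toFinset.mpr (h i hi)
    have hcard : (L.toFinset \ normal χ g).card + codim χ g = L.length := by
      rw [← List.toFinset_card_of_nodup hL]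
      exact Finset.card_sdiff_add_card_eq_card hnorm
    have htang : L.toFinset \ normal χ g ⊆ tang χ g := fun i hi =>
      (mem_tang_iff_notMem_normal χ).mpr (Finset.mem_sdiff.mp hi).2
    simp only [projSec, LinearMap.sum_apply, LinearMap.smulRight_apply]
    rw [Finset.sum_eq_single ⟨L.toFinset \ normal χ g, htang, hcard⟩]
    · rw [Lam_eq, ← wedge_append]
      refine extCoeff_smul_wedge_perm (nodup_sort_append_normal χ htang) ?_
      refine (List.perm_ext_iff_of_nodup (nodup_sort_append_normal χ htang) hL).mpr fun i => ?_
      have := h i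
      simp only [List.mem_append, Finset.mem_sort, Finset.mem_sdiff, List.mem_toFinset]
      tauto
    · rintro ⟨I, hI, hI'⟩ _ hne
      have : extCoeff (I.sort ++ (normal χ g).sort) (wedge L) = 0 := by
        by_contra h0
        have hp := perm_of_extCoeff_wedge_ne_zero (nodup_sort_append_normal χ hI) h0
        apply hne
        ext i
        have h1 := hp.mem_iff (a := i)
        have h2 := fun hi : i ∈ I => (mem_tang_iff_notMem_normal χ).mp (hI hi)
        simp only [List.mem_append, Finset.mem_sort] at h1
        simp only [Finset.mem_sdiff, List.mem_toFinset]
        tauto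
      rw [this, zero_smul]
    · exact fun h => absurd (Finset.mem_univ _) h
  · rw [wedge_eq_zero_of_not_nodup hL, map_zero]

theorem projSec_wedge_of_notMem {g : G} {i : Fin n} (hi : i ∈ normal χ g) {L : List (Fin n)}
    (h : i ∉ L) (N : ℕ) : projSec χ g N (wedge L) = 0 := by
  simp only [projSec, LinearMap.sum_apply, LinearMap.smulRight_apply]
  refine Finset.sum_eq_zero fun I _ => ?_
  rw [extCoeff_wedge_of_notMem (i := i) (by simp [hi]) h, zero_smul]

/-! ### The map `L` on normalized cochains -/

/-- The antisymmetrization in `L_2` may be omitted: permuting the slots permutes the factors of the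
monomial `∂_{j_1} ∧ … ∧ ∂_{j_N}`, and the two signs cancel. -/
theorem L2_eq_sum_atPoint {N : ℕ} (Ψ : Cochain N (Poly n) (Poly n)) :
    L2 Ψ = ∑ j : Fin N → Fin n, atPoint Ψ j ⊗ₜ[ℂ] wedge (List.ofFn j) := by
  have h1 : ∀ σ : Equiv.Perm (Fin N), ∑ i : Fin N → Fin n,
      (Equiv.Perm.sign σ • atPoint Ψ fun s => i (σ.symm s)) ⊗ₜ[ℂ] wedge (List.ofFn i) =
      ∑ j : Fin N → Fin n, atPoint Ψ j ⊗ₜ[ℂ] wedge (List.ofFn j) := by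
    intro σ
    refine Fintype.sum_equiv (Equiv.arrowCongr σ (Equiv.refl _)) _ _ fun i => ?_
    have h2 : wedge (List.ofFn i) = Equiv.Perm.sign σ •
        wedge (List.ofFn ((Equiv.arrowCongr σ (Equiv.refl (Fin n))) i)) := by
      rw [← wedge_ofFn_perm]
      congr 2; funext a; simp [Equiv.arrowCongr]
    rw [h2, Units.smul_def, Units.smul_def, ← TensorProduct.smul_tmul', TensorProduct.tmul_smul,
      smul_smul, ← Units.val_mul, ← sq, Int.units_sq]
    simp only [Units.val_one, one_smul]
    rfl
  simp only [L2, TensorProduct.sum_tmul, ← TensorProduct.smul_tmul', Finset.smul_sum]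
  rw [Finset.sum_comm]
  have hN : (N.factorial : ℂ) ≠ 0 := by exact_mod_cast N.factorial_ne_zero
  simp only [← Finset.smul_sum]
  simp only [TensorProduct.smul_tmul'] at h1 ⊢
  rw [Finset.sum_congr rfl fun σ _ => h1 σ, Finset.sum_const, Finset.card_univ,
    Fintype.card_perm, Fintype.card_fin, ← Nat.cast_smul_eq_nsmul ℂ, smul_smul,
    inv_mul_cancel₀ hN, one_smul]

/-- A cochain that does not change when constants are added to its arguments. It is a condition on
functions, so that multilinearity need not be known. -/
def IsNormalized {N : ℕ} (Ψ : (Fin N → Poly n) → Poly n) : Prop :=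
  ∀ (f : Fin N → Poly n) (c : Fin N → ℂ), Ψ (fun r => f r + C (c r)) = Ψ f

/-- On a normalized cochain the shift of the arguments to the point of evaluation has no effect. -/
theorem atPoint_eq_of_isNormalized {N : ℕ} {Ψ : Cochain N (Poly n) (Poly n)}
    (h : IsNormalized Ψ) (j : Fin N → Fin n) : atPoint Ψ j = Ψ fun s => X (j s) := by
  refine MvPolynomial.funext fun p => ?_
  rw [eval_atPoint]
  have := h (fun s => X (j s)) fun s => - p (j s)
  simp only [C_neg, ← sub_eq_add_neg] at this
  rw [this]

end Projection

/-! ### Divided differences -/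

section DividedDiff

variable {G : Type*} [CommGroup G] {n : ℕ} (χ : Fin n → G →* ℂˣ)

theorem X_sub_act_X_ne_zero {g : G} {i : Fin n} (hi : i ∈ normal χ g) :
    (X i - act χ g (X i) : Poly n) ≠ 0 := by
  have h1 : (X i - act χ g (X i) : Poly n) = C (1 - (χ i g : ℂ)) * X i := by
    simp [act, sub_mul]
  rw [h1]
  refine mul_ne_zero (fun h => ?_) (X_ne_zero i)
  rw [C_eq_zero, sub_eq_zero] at h
  exact (mem_normal χ).mp hi (Units.ext h.symm)

theorem dividedDiff_eq_of_mul_eq {g : G} {i : Fin n} (hi : i ∈ normal χ g) {S : Finset (Fin n)}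
    {f q : Poly n}
    (h : q * (X i - act χ g (X i)) = partialTwist χ g S f - partialTwist χ g (insert i S) f) :
    dividedDiff χ g S i f = q :=
  mul_right_cancel₀ (X_sub_act_X_ne_zero χ hi) ((dividedDiff_spec χ g S i hi f).trans h.symm)

theorem dividedDiff_C {g : G} {i : Fin n} (hi : i ∈ normal χ g) (S : Finset (Fin n)) (c : ℂ) :
    dividedDiff χ g S i (C c) = 0 :=
  dividedDiff_eq_of_mul_eq χ hi (by simp [partialTwist])

theorem dividedDiff_X {g : G} {i : Fin n} (hi : i ∈ normal χ g) {S : Finset (Fin n)} (hS : i ∉ S)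
    (j : Fin n) : dividedDiff χ g S i (X j) = if j = i then 1 else 0 := by
  refine dividedDiff_eq_of_mul_eq χ hi ?_
  by_cases h : j = i
  · subst h; simp [partialTwist, hS, act]
  · simp [partialTwist, h]

theorem act_partialTwist (g h : G) (S : Finset (Fin n)) (f : Poly n) :
    partialTwist χ g S (act χ h f) = act χ h (partialTwist χ g S f) := by
  have : (partialTwist χ g S).comp (act χ h) = (act χ h).comp (partialTwist χ g S) := by
    ext1 i
    simp only [AlgHom.comp_apply, act, partialTwist, aeval_X, map_mul, algHom_C, algebraMap_eq]
    split_ifs <;> simp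
    ring
  exact DFunLike.congr_fun this f

theorem dividedDiff_act {g : G} {i : Fin n} (hi : i ∈ normal χ g) (S : Finset (Fin n)) (h : G)
    (f : Poly n) :
    dividedDiff χ g S i (act χ h f) = (χ i h : ℂ) • act χ h (dividedDiff χ g S i f) := by
  refine dividedDiff_eq_of_mul_eq χ hi ?_
  rw [act_partialTwist, act_partialTwist, ← map_sub, ← dividedDiff_spec χ g S i hi, map_mul,
    smul_mul_assoc, ← mul_smul_comm]
  congr 1
  simp only [act, map_sub, aeval_X, map_mul, algHom_C, algebraMap_eq, smul_eq_C_mul]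
  ring

/-- The twisted Leibniz rule for divided differences. -/
theorem dividedDiff_mul_X {g : G} {i : Fin n} (hi : i ∈ normal χ g) (S : Finset (Fin n))
    (f : Poly n) (j : Fin n) :
    dividedDiff χ g S i (f * X j) = dividedDiff χ g S i f * partialTwist χ g S (X j) +
      partialTwist χ g (insert i S) f * dividedDiff χ g S i (X j) := by
  refine dividedDiff_eq_of_mul_eq χ hi ?_
  have h1 := dividedDiff_spec χ g S i hi f
  have h2 := dividedDiff_spec χ g S i hi (X j)
  rw [map_mul, map_mul]
  linear_combination partialTwist χ g S (X j) * h1 + partialTwist χ g (insert i S) f * h2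

theorem restrictFn_partialTwist {g g' : G} {S : Finset (Fin n)} (hS : S ⊆ normal χ g')
    (f : Poly n) : restrictFn χ g' (partialTwist χ g S f) = restrictFn χ g' f := by
  have : (restrictFn χ g').comp (partialTwist χ g S) = restrictFn χ g' := by
    ext1 i
    simp only [AlgHom.comp_apply, partialTwist, aeval_X]
    split_ifs with h
    · have : i ∉ tang χ g' := fun h' => (mem_tang_iff_notMem_normal χ).mp h' (hS h)
      simp [restrictFn, this]
    · rfl
  exact DFunLike.congr_fun this f

/-- On the fixed space of an element that moves `x^i` and the coordinates in `S`, the divided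
difference is the partial derivative. -/
theorem restrictFn_dividedDiff {g g' : G} {i : Fin n} (hi : i ∈ normal χ g)
    (hi' : i ∈ normal χ g') {S : Finset (Fin n)} (hS : S ⊆ normal χ g') (hiS : i ∉ S)
    (f : Poly n) :
    restrictFn χ g' (dividedDiff χ g S i f) = restrictFn χ g' (pderiv i f) := by
  induction f using MvPolynomial.induction_on with
  | C a => rw [dividedDiff_C χ hi, pderiv_C]
  | add p q hp hq => simp only [map_add, hp, hq]
  | mul_X p j hp =>
    rw [dividedDiff_mul_X χ hi, Derivation.leibniz, map_add, map_mul, map_mul, hp,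
      restrictFn_partialTwist χ hS, restrictFn_partialTwist χ (Finset.insert_subset hi' hS),
      dividedDiff_X χ hi hiS, pderiv_X, map_add, smul_eq_mul, smul_eq_mul, map_mul, map_mul]
    by_cases h : j = i
    · subst h; simp; ring
    · rw [Pi.single_eq_of_ne h]; simp [h]; ring

theorem dividedDiff_extendFn {g mu : G} {i : Fin n} (hi : i ∈ normal χ g)
    (hi' : i ∈ normal χ mu) (S : Finset (Fin n)) (f : PolyFix χ mu) :
    dividedDiff χ g S i (extendFn χ mu f) = 0 := by
  refine dividedDiff_eq_of_mul_eq χ hi ?_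
  rw [zero_mul, eq_comm, sub_eq_zero]
  have : (partialTwist χ g S).comp (extendFn χ mu) =
      (partialTwist χ g (insert i S)).comp (extendFn χ mu) := by
    ext1 j
    have hj : j.1 ≠ i := fun h => (mem_tang_iff_notMem_normal χ).mp j.2 (h ▸ hi')
    simp [extendFn, partialTwist, hj]
  exact DFunLike.congr_fun this f

theorem pderiv_extendFn_of_mem_normal {mu : G} {i : Fin n} (hi : i ∈ normal χ mu)
    (f : PolyFix χ mu) : pderiv i (extendFn χ mu f) = 0 := by
  classical
  refine pderiv_eq_zero_of_notMem_vars fun h => ?_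
  have := vars_rename (Subtype.val : {i // i ∈ tang χ mu} → Fin n) f h
  obtain ⟨j, _, hj⟩ := Finset.mem_image.mp this
  exact (mem_tang_iff_notMem_normal χ).mp j.2 (hj ▸ hi)

theorem pderiv_act (i : Fin n) (h : G) (f : Poly n) :
    pderiv i (act χ h f) = (χ i h : ℂ) • act χ h (pderiv i f) := by
  induction f using MvPolynomial.induction_on with
  | C a => simp [act]
  | add p q hp hq => simp only [map_add, hp, hq, smul_add]
  | mul_X p j hp =>
    rw [map_mul, Derivation.leibniz, hp, Derivation.leibniz, map_add, smul_eq_mul, smul_eq_mul,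
      smul_eq_mul, smul_eq_mul, map_mul, map_mul, smul_add, mul_smul_comm]
    congr 1
    by_cases hj : j = i
    · subst hj; simp [act, smul_eq_C_mul]; ring
    · simp [act, pderiv_X_of_ne hj]

end DividedDiff

/-! ### The cochains `T_1^g ξ` as sums of products of one-slot operators -/

section Slot

variable {G : Type*} [CommGroup G] {n : ℕ} (χ : Fin n → G →* ℂˣ) {g : G} {m k : ℕ}

theorem yIdx_mem_normal (a : Fin (codim χ g)) : yIdx χ g a ∈ normal χ g :=
  Finset.orderEmbOfFin_mem _ _ _

theorem yIdx_injective : Function.Injective (yIdx χ g) :=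
  ((normal χ g).orderEmbOfFin rfl).injective

theorem exists_yIdx_eq {i : Fin n} (hi : i ∈ normal χ g) : ∃ a, yIdx χ g a = i := by
  have := Finset.range_orderEmbOfFin (normal χ g) rfl
  have h : i ∈ Set.range ((normal χ g).orderEmbOfFin rfl) := by rw [this]; exact hi
  exact h

theorem ofFn_yIdx : List.ofFn (yIdx χ g) = (normal χ g).sort := by
  refine List.ext_getElem (by rw [List.length_ofFn, length_sort_normal]) fun a h1 h2 => ?_
  rw [List.getElem_ofFn]; rfl

variable (h : m + codim χ g = k) (t : Fin m → {i // i ∈ tang χ g})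
  (σ : Equiv.Perm (Fin (codim χ g)))

/-- The indices `t_1, …, t_m, σ(1), …, σ(l(g))` of the coordinates that are differentiated in the
slots of the summand of `T_1^g ξ` with index `(t, σ)`; the `k` slots are split by `h` into `m` slots
for `X` and `l(g)` slots for `Ω_g`. -/
def word : Fin k → Fin n := fun r =>
  Fin.append (fun a => (t a).1) (fun a => yIdx χ g (σ a)) (Fin.cast h.symm r)

/-- The operators acting on the slots of the summand of `T_1^g ξ` with index `(t, σ)`: partial
derivatives, followed by divided differences. -/
def slotOp : Fin k → (Poly n →ₗ[ℂ] Poly n) := fun r =>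
  Fin.append (fun a => (pderiv (R := ℂ) (t a).1).toLinearMap)
    (fun a => dividedDiff χ g ((Finset.Iio a).image fun s => yIdx χ g (σ s)) (yIdx χ g (σ a)))
    (Fin.cast h.symm r)

/-- The coefficient of the summand of `T_1^g ξ` with index `(t, σ)`. -/
def slotCoeff (g : G) (t : Fin m → {i // i ∈ tang χ g}) (σ : Equiv.Perm (Fin (codim χ g)))
    (ξ : MVFix χ g) : Poly n :=
  (((m.factorial : ℂ)⁻¹ * ((codim χ g).factorial : ℂ)⁻¹) * ((Equiv.Perm.sign σ : ℤ) : ℂ)) •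
    extendFn χ g (coeffX χ g (List.ofFn fun r => (t r).1) ξ)

theorem slot_cases (r : Fin k) : (∃ a, r = Fin.cast h (Fin.castAdd _ a)) ∨
    ∃ a, r = Fin.cast h (Fin.natAdd m a) := by
  subst h
  refine Fin.addCases (fun a => Or.inl ⟨a, rfl⟩) (fun a => Or.inr ⟨a, rfl⟩) r

theorem word_left (a : Fin m) : word χ h t σ (Fin.cast h (Fin.castAdd _ a)) = (t a).1 := by
  simp [word]

theorem word_right (a : Fin (codim χ g)) :
    word χ h t σ (Fin.cast h (Fin.natAdd m a)) = yIdx χ g (σ a) := by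
  simp [word]

theorem slotOp_left (a : Fin m) : slotOp χ h t σ (Fin.cast h (Fin.castAdd _ a)) =
    (pderiv (R := ℂ) (t a).1).toLinearMap := by
  simp [slotOp]

theorem slotOp_right (a : Fin (codim χ g)) :
    slotOp χ h t σ (Fin.cast h (Fin.natAdd m a)) =
      dividedDiff χ g ((Finset.Iio a).image fun s => yIdx χ g (σ s)) (yIdx χ g (σ a)) := by
  simp [slotOp]

theorem yIdx_notMem_image (a : Fin (codim χ g)) :
    yIdx χ g (σ a) ∉ (Finset.Iio a).image fun s => yIdx χ g (σ s) := by
  intro h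
  obtain ⟨s, hs, hs'⟩ := Finset.mem_image.mp h
  have := σ.injective (yIdx_injective χ hs')
  subst this
  simp at hs

theorem slotOp_X (r : Fin k) (i : Fin n) :
    slotOp χ h t σ r (X i) = if i = word χ h t σ r then 1 else 0 := by
  rcases slot_cases χ h r with ⟨a, rfl⟩ | ⟨a, rfl⟩
  · rw [slotOp_left, word_left]
    by_cases hi : i = (t a).1
    · subst hi; simp
    · rw [if_neg hi]; exact pderiv_X_of_ne hi
  · rw [slotOp_right, word_right]
    exact dividedDiff_X χ (yIdx_mem_normal χ _) (yIdx_notMem_image χ σ a) i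

theorem slotOp_C (r : Fin k) (c : ℂ) : slotOp χ h t σ r (C c) = 0 := by
  rcases slot_cases χ h r with ⟨a, rfl⟩ | ⟨a, rfl⟩
  · rw [slotOp_left]; exact pderiv_C
  · rw [slotOp_right]; exact dividedDiff_C χ (yIdx_mem_normal χ _) _ c

theorem slotOp_act (r : Fin k) (g' : G) (f : Poly n) :
    slotOp χ h t σ r (act χ g' f) =
      (χ (word χ h t σ r) g' : ℂ) • act χ g' (slotOp χ h t σ r f) := by
  rcases slot_cases χ h r with ⟨a, rfl⟩ | ⟨a, rfl⟩
  · rw [slotOp_left, word_left]; exact pderiv_act χ _ g' f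
  · rw [slotOp_right, word_right]; exact dividedDiff_act χ (yIdx_mem_normal χ _) _ g' f

theorem restrictFn_slotOp {g' : G} (hg : normal χ g ⊆ normal χ g') (r : Fin k) (f : Poly n) :
    restrictFn χ g' (slotOp χ h t σ r f) = restrictFn χ g' (pderiv (word χ h t σ r) f) := by
  rcases slot_cases χ h r with ⟨a, rfl⟩ | ⟨a, rfl⟩
  · rw [slotOp_left, word_left]; rfl
  · rw [slotOp_right, word_right]
    refine restrictFn_dividedDiff χ (yIdx_mem_normal χ _) (hg (yIdx_mem_normal χ _))
      (fun i hi => ?_) (yIdx_notMem_image χ σ a) f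
    obtain ⟨s, _, rfl⟩ := Finset.mem_image.mp hi
    exact hg (yIdx_mem_normal χ _)

theorem slotOp_extendFn_of_mem_normal {mu : G} (r : Fin k)
    (hr : word χ h t σ r ∈ normal χ mu) (f : PolyFix χ mu) :
    slotOp χ h t σ r (extendFn χ mu f) = 0 := by
  rcases slot_cases χ h r with ⟨a, rfl⟩ | ⟨a, rfl⟩
  · rw [word_left] at hr
    rw [slotOp_left]; exact pderiv_extendFn_of_mem_normal χ hr f
  · rw [word_right] at hr
    rw [slotOp_right]; exact dividedDiff_extendFn χ (yIdx_mem_normal χ _) hr _ f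

theorem exists_word_eq {i : Fin n} (hi : i ∈ normal χ g) : ∃ r, word χ h t σ r = i := by
  obtain ⟨a, rfl⟩ := exists_yIdx_eq χ hi
  exact ⟨Fin.cast h (Fin.natAdd m (σ.symm a)), by rw [word_right, σ.apply_symm_apply]⟩

theorem sharp_apply {m p k : ℕ} (h : m + p = k) (φ : Cochain m (Poly n) (Poly n))
    (ψ : Cochain p (Poly n) (Poly n)) (F : Fin k → Poly n) :
    sharp h φ ψ F = φ (fun a => F (Fin.cast h (Fin.castAdd _ a))) *
      ψ fun a => F (Fin.cast h (Fin.natAdd m a)) := by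
  simp [sharp, MultilinearMap.domCoprod]

/-- `T_1^g ξ` is a combination of products of operators each acting on a single argument. -/
theorem T1g_apply (h : m + codim χ g = k) (ξ : MVFix χ g) (F : Fin k → Poly n) :
    T1g χ g k ξ F = ∑ t : Fin m → {i // i ∈ tang χ g}, ∑ σ : Equiv.Perm (Fin (codim χ g)),
      slotCoeff χ g t σ ξ * ∏ r, slotOp χ h t σ r (F r) := by
  obtain rfl : m = k - codim χ g := by omega
  rw [T1g, dif_pos (by omega), smul_apply, sum_apply,
    Finset.smul_sum]
  refine Finset.sum_congr rfl fun t _ => ?_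
  have hprod : ∀ σ : Equiv.Perm (Fin (codim χ g)), ∏ r, slotOp χ h t σ r (F r) =
      (∏ a, slotOp χ h t σ (Fin.cast h (Fin.castAdd _ a)) (F (Fin.cast h (Fin.castAdd _ a)))) *
        ∏ a, slotOp χ h t σ (Fin.cast h (Fin.natAdd _ a)) (F (Fin.cast h (Fin.natAdd _ a))) := by
    intro σ
    rw [← Fin.prod_univ_add
      (f := fun r => slotOp χ h t σ (Fin.cast h r) (F (Fin.cast h r)))]
    exact (Fintype.prod_equiv (finCongr h) _ _ fun _ => rfl).symm
  simp only [hprod, slotOp_left, slotOp_right]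
  simp only [LinearMap.compMultilinearMap_apply, sharp_apply, derivs, Omega,
    MultilinearMap.compLinearMap_apply, MultilinearMap.mkPiAlgebra_apply,
    smul_apply, sum_apply, LinearMap.mulLeft_apply, Finset.mul_sum,
    Finset.smul_sum, slotCoeff]
  refine Finset.sum_congr rfl fun σ _ => ?_
  simp only [Units.smul_def, ← Int.cast_smul_eq_zsmul ℂ,
    mul_smul_comm, smul_mul_assoc, smul_smul, mul_assoc]

theorem T1g_eq_zero_of_lt (h : k < codim χ g) (ξ : MVFix χ g) : T1g χ g k ξ = 0 := by
  rw [T1g, dif_neg (by omega)]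

theorem eq_zero_of_mem_Sec_of_lt (h : k < codim χ g) {ξ : MVFix χ g} (hξ : ξ ∈ Sec χ g k) :
    ξ = 0 := by
  have : Sec χ g k = ⊥ := by
    rw [Sec, Submodule.span_eq_bot]
    rintro _ ⟨I, p, _, hI, _⟩
    omega
  rw [this] at hξ
  exact (Submodule.mem_bot ℂ).mp hξ

/-- Extension of sections over `V^g` to multivector fields on `V` that are constant along `N^g`. -/
def extSec (g : G) : MVFix χ g →ₗ[ℂ] Poly n ⊗[ℂ] Ext n :=
  (extendFn χ g).toLinearMap.rTensor (Ext n)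

theorem coeffX_tmul (T : List (Fin n)) (p : PolyFix χ g) (e : Ext n) :
    coeffX χ g T (p ⊗ₜ[ℂ] e) = extCoeff (T ++ (normal χ g).sort) e • p := by
  simp [coeffX, mcoeff]

theorem wedge_ofFn_word : wedge (List.ofFn (word χ h t σ)) =
    Equiv.Perm.sign σ • (wedge (List.ofFn fun r => (t r).1) * Lam χ g) := by
  subst h
  have : word χ rfl t σ = Fin.append (fun a => (t a).1) (fun a => yIdx χ g (σ a)) := rfl
  rw [this, List.ofFn_fin_append, wedge_append, wedge_ofFn_perm, ofFn_yIdx, mul_smul_comm, Lam_eq]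

/-- The sum over all words, divided by the number of their rearrangements, is the sum over
increasing words. -/
theorem sum_extCoeff_smul_wedge {I : Finset (Fin n)} (hI : I ⊆ tang χ g) (hm : I.card = m) :
    ∑ t : Fin m → {i // i ∈ tang χ g},
      extCoeff ((List.ofFn fun r => (t r).1) ++ (normal χ g).sort) (wedge I.sort * Lam χ g) •
        (wedge (List.ofFn fun r => (t r).1) * Lam χ g) =
      (m.factorial : ℂ) • (wedge I.sort * Lam χ g) := by
  let e : Fin m → {i // i ∈ tang χ g} := fun a =>
    ⟨I.orderEmbOfFin hm a, hI (Finset.orderEmbOfFin_mem _ _ _)⟩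
  have he : Function.Injective e := fun a b hab => by
    have h1 : (e a).1 = (e b).1 := by rw [hab]
    exact (I.orderEmbOfFin hm).injective h1
  have heI : List.ofFn (fun r => (e r).1) = I.sort := by
    subst hm
    refine List.ext_getElem (by simp) fun a h1 h2 => ?_
    rw [List.getElem_ofFn]; rfl
  have hnd := nodup_sort_append_normal χ hI
  simp only [Lam_eq, ← wedge_append]
  rw [← Fintype.sum_of_injective (fun (π : Equiv.Perm (Fin m)) => e ∘ π) ?_
    (fun _ => wedge (I.sort ++ (normal χ g).sort))]
  · rw [Finset.sum_const, Finset.card_univ, Fintype.card_perm, Fintype.card_fin,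
      Nat.cast_smul_eq_nsmul]
  · intro t ht
    by_contra hne
    have h0 : extCoeff ((List.ofFn fun r => (t r).1) ++ (normal χ g).sort)
        (wedge (I.sort ++ (normal χ g).sort)) ≠ 0 := fun h0 => hne (by rw [h0, zero_smul])
    have hnd' : ((List.ofFn fun r => (t r).1) ++ (normal χ g).sort).Nodup := by
      by_contra hnd'
      exact h0 (extCoeff_eq_zero_of_not_nodup hnd' _)
    have hp := perm_of_extCoeff_wedge_ne_zero hnd' h0
    have hp' := (List.perm_append_right_iff _).mp hp
    rw [← heI] at hp'
    have hex : ∀ a, ∃ b, e b = t a := by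
      intro a
      have : (t a).1 ∈ List.ofFn fun r => (e r).1 :=
        hp'.mem_iff.mp (List.mem_ofFn.mpr ⟨a, rfl⟩)
      obtain ⟨b, hb⟩ := List.mem_ofFn.mp this
      exact ⟨b, Subtype.ext hb⟩
    choose π hπ using hex
    have htinj : Function.Injective t := by
      have := List.nodup_ofFn.mp (List.nodup_append.mp hnd').1
      exact fun a b hab => this (congrArg Subtype.val hab)
    have hπi : Function.Injective π := fun a b hab => htinj (by rw [← hπ a, ← hπ b, hab])
    exact ht ⟨Equiv.ofBijective π (Finite.injective_iff_bijective.mp hπi), funext hπ⟩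
  · intro π
    have hperm : (List.ofFn fun r => ((e ∘ π) r).1).Perm I.sort := by
      rw [← heI]
      exact Equiv.Perm.ofFn_comp_perm π fun r => (e r).1
    have hp2 := hperm.append_right (normal χ g).sort
    exact (extCoeff_smul_wedge_perm (hp2.nodup_iff.mpr hnd) hp2).symm
  · exact fun π π' hππ => Equiv.ext fun a => he (congrFun hππ a)

/-- The symbol of `T_1^g ξ`, which has `∂_i` for every slot that differentiates along `x^i`, is `ξ`.
The sums over `t` and `σ` undo the averages in `T_1^g` since wedge monomials are alternating. -/
theorem sum_slotCoeff_tmul_wedge (h : m + codim χ g = k) {ξ : MVFix χ g} (hξ : ξ ∈ Sec χ g k) :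
    ∑ t : Fin m → {i // i ∈ tang χ g}, ∑ σ : Equiv.Perm (Fin (codim χ g)),
      slotCoeff χ g t σ ξ ⊗ₜ[ℂ] wedge (List.ofFn (word χ h t σ)) = extSec χ g ξ := by
  have hf : ∀ a : ℕ, (a.factorial : ℂ) ≠ 0 := fun a => by exact_mod_cast a.factorial_ne_zero
  have h1 : ∀ t : Fin m → {i // i ∈ tang χ g}, ∑ σ : Equiv.Perm (Fin (codim χ g)),
      slotCoeff χ g t σ ξ ⊗ₜ[ℂ] wedge (List.ofFn (word χ h t σ)) =
      (m.factorial : ℂ)⁻¹ • extendFn χ g (coeffX χ g (List.ofFn fun r => (t r).1) ξ) ⊗ₜ[ℂ]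
        (wedge (List.ofFn fun r => (t r).1) * Lam χ g) := by
    intro t
    have h2 : ∀ σ : Equiv.Perm (Fin (codim χ g)),
        slotCoeff χ g t σ ξ ⊗ₜ[ℂ] wedge (List.ofFn (word χ h t σ)) =
        ((m.factorial : ℂ)⁻¹ * ((codim χ g).factorial : ℂ)⁻¹) •
          extendFn χ g (coeffX χ g (List.ofFn fun r => (t r).1) ξ) ⊗ₜ[ℂ]
          (wedge (List.ofFn fun r => (t r).1) * Lam χ g) := by
      intro σ
      rw [wedge_ofFn_word, slotCoeff, Units.smul_def, ← Int.cast_smul_eq_zsmul ℂ,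
        TensorProduct.tmul_smul, ← TensorProduct.smul_tmul', smul_smul]
      congr 1
      have : (((Equiv.Perm.sign σ : ℤ) : ℂ)) * ((Equiv.Perm.sign σ : ℤ) : ℂ) = 1 := by
        rw [← Int.cast_mul, ← Units.val_mul, Int.units_mul_self]; simp
      linear_combination ((m.factorial : ℂ)⁻¹ * ((codim χ g).factorial : ℂ)⁻¹) * this
    rw [Finset.sum_congr rfl fun σ _ => h2 σ, Finset.sum_const, Finset.card_univ,
      Fintype.card_perm, Fintype.card_fin, ← Nat.cast_smul_eq_nsmul ℂ, smul_smul]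
    congr 1
    field_simp [hf]
  rw [Finset.sum_congr rfl fun t _ => h1 t]
  clear h1
  induction hξ using Submodule.span_induction with
  | zero => simp [coeffX]
  | add x y _ _ hx hy =>
    rw [map_add, ← hx, ← hy, ← Finset.sum_add_distrib]
    refine Finset.sum_congr rfl fun t _ => ?_
    simp only [coeffX, map_add, TensorProduct.add_tmul, smul_add]
  | smul c x _ hx =>
    rw [map_smul, ← hx, Finset.smul_sum]
    refine Finset.sum_congr rfl fun t _ => ?_
    rw [smul_comm c]
    simp only [coeffX, map_smul, TensorProduct.smul_tmul']
  | mem x hx =>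
    obtain ⟨I, p, hI, hIk, rfl⟩ := hx
    have hm : I.card = m := by omega
    have h3 := congrArg (fun e => (m.factorial : ℂ)⁻¹ • (extendFn χ g p ⊗ₜ[ℂ] e))
      (sum_extCoeff_smul_wedge χ hI hm)
    simp only [TensorProduct.tmul_smul, smul_smul, inv_mul_cancel₀ (hf m), one_smul,
      TensorProduct.tmul_sum, Finset.smul_sum] at h3
    simp only [coeffX_tmul, map_smul, ← TensorProduct.smul_tmul', smul_smul]
    exact h3

end Slot

/-! ### Equivariance of the cochains `T_1^g ξ` -/

section Equivariance

variable {G : Type*} [CommGroup G] {n : ℕ} (χ : Fin n → G →* ℂˣ) {g : G} {m k : ℕ}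

theorem extCoeff_map_diag (T : List (Fin n)) (d : Fin n → ℂ) (e : Ext n) :
    extCoeff T (ExteriorAlgebra.map (LinearMap.pi fun i => d i • LinearMap.proj i) e) =
      (T.map d).prod * extCoeff T e := by
  have : (extCoeff T).comp
      (ExteriorAlgebra.map (LinearMap.pi fun i => d i • LinearMap.proj i)).toLinearMap =
      (T.map d).prod • extCoeff T := by
    refine ExteriorAlgebra.lhom_ext fun N => ?_
    ext v
    simp only [LinearMap.compAlternatingMap_apply, LinearMap.comp_apply, AlgHom.toLinearMap_apply,
      LinearMap.smul_apply, ExteriorAlgebra.map_apply_ιMulti, extCoeff,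
      ExteriorAlgebra.liftAlternating_apply_ιMulti]
    by_cases hN : N = T.length
    · subst hN
      rw [Pi.single_eq_same, ← List.ofFn_get (T.map d), List.prod_ofFn]
      refine Eq.trans ?_ ((Matrix.det_mul_row (fun b => d (T.get b))
        (fun a b => v a (T.get b))).trans ?_)
      · rfl
      · rw [smul_eq_mul]
        congr 1
        refine Fintype.prod_equiv (finCongr (by simp)) _ _ fun b => ?_
        simp
    · rw [Pi.single_eq_of_ne hN]; simp
  exact LinearMap.congr_fun this e

theorem act_extendFn (h : G) (p : PolyFix χ g) :
    act χ h (extendFn χ g p) = extendFn χ g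
      ((aeval fun i : {i // i ∈ tang χ g} => C (χ i.1 h : ℂ) * X i : PolyFix χ g →ₐ[ℂ] _) p) := by
  have : (act χ h).comp (extendFn χ g) = (extendFn χ g).comp
      (aeval fun i : {i // i ∈ tang χ g} => C (χ i.1 h : ℂ) * X i : PolyFix χ g →ₐ[ℂ] _) := by
    ext1 i; simp [act, extendFn]
  exact DFunLike.congr_fun this p

theorem coeffX_push (h : G) (T : List (Fin n)) (ξ : MVFix χ g) :
    extendFn χ g (coeffX χ g T (push χ g h ξ)) =
      ((T ++ (normal χ g).sort).map fun i => ((χ i h⁻¹ : ℂˣ) : ℂ)).prod •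
        act χ h (extendFn χ g (coeffX χ g T ξ)) := by
  induction ξ using TensorProduct.induction_on with
  | zero => simp [coeffX]
  | add a b ha hb =>
    simp only [coeffX, map_add, smul_add] at ha hb ⊢
    rw [ha, hb]
  | tmul p e =>
    rw [push, TensorProduct.map_tmul, coeffX_tmul, coeffX_tmul, AlgHom.toLinearMap_apply,
      extCoeff_map_diag, map_smul, map_smul, map_smul, act_extendFn, smul_smul]
    rfl

theorem prod_word (h : m + codim χ g = k) (t : Fin m → {i // i ∈ tang χ g})
    (σ : Equiv.Perm (Fin (codim χ g))) (d : Fin n → ℂ) :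
    ∏ r, d (word χ h t σ r) = (((List.ofFn fun r => (t r).1) ++ (normal χ g).sort).map d).prod := by
  subst h
  have hw : ∀ r, word χ rfl t σ r =
      Fin.append (fun a => (t a).1) (fun a => yIdx χ g (σ a)) r := fun _ => rfl
  simp only [hw]
  rw [Fin.prod_univ_add, ← ofFn_yIdx, List.map_append, List.prod_append, List.map_ofFn,
    List.map_ofFn, List.prod_ofFn, List.prod_ofFn]
  simp only [Fin.append_left, Fin.append_right, Function.comp_apply]
  rw [Equiv.prod_comp σ fun a => d (yIdx χ g a)]

/-- For invariant `ξ` the factors by which `G` scales the operators in the slots cancel against those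
of the coefficient. -/
theorem T1g_act {ξ : MVFix χ g} (hξ : ∀ h, push χ g h ξ = ξ) (h : G) (F : Fin k → Poly n) :
    T1g χ g k ξ (fun r => act χ h (F r)) = act χ h (T1g χ g k ξ F) := by
  rcases lt_or_ge k (codim χ g) with hk | hk
  · simp [T1g_eq_zero_of_lt χ hk]
  have hk' : k - codim χ g + codim χ g = k := Nat.sub_add_cancel hk
  simp only [T1g_apply χ hk', map_sum]
  refine Finset.sum_congr rfl fun t _ => Finset.sum_congr rfl fun σ _ => ?_
  simp only [slotOp_act, map_mul, map_prod]
  rw [Finset.prod_smul, mul_smul_comm, ← smul_mul_assoc]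
  congr 1
  rw [prod_word χ hk' t σ fun i => (χ i h : ℂ), slotCoeff, map_smul, smul_comm]
  congr 1
  have h1 := coeffX_push χ h (List.ofFn fun r => (t r).1) ξ
  rw [hξ] at h1
  have h2 : ∀ L : List (Fin n), (L.map fun i => (χ i h : ℂ)).prod *
      (L.map fun i => ((χ i h⁻¹ : ℂˣ) : ℂ)).prod = 1 := by
    intro L
    rw [← List.prod_map_mul]
    simp
  conv_lhs => rw [h1]
  rw [smul_smul, h2, one_smul]

end Equivariance

/-! ### The pre-Lie product on polynomial arguments -/

section PreLie

open SkewMonoidAlgebra (single coeff_single_apply single_mul_single coeff_mul_single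
  coeff_single_mul lsingle_apply)

variable {G : Type*} [CommGroup G] {n : ℕ} (χ : Fin n → G →* ℂˣ)

theorem coeffAt_single {G : Type*} [DecidableEq G] (g h : G) (b : Poly n) :
    coeffAt g (single h b : Crossed G n) = if h = g then b else 0 := by
  change (single h b).coeff g = _
  rw [coeff_single_apply]

theorem mulU_single (g h : G) (b : Poly n) :
    mulU χ g (single h b : Crossed G n) = single (h * g) b := by
  let := polyAction χ
  change single h b * single g 1 = _
  rw [single_mul_single]
  congr 1
  rw [smul_one, mul_one]

theorem coeffAt_conjU (g h : G) (b : Crossed G n) :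
    coeffAt g (conjU χ h b) = act χ h⁻¹ (coeffAt g b) := by
  let := polyAction χ
  change (single h⁻¹ 1 * b * single h 1).coeff g = _
  rw [coeff_mul_single, coeff_single_mul, smul_one, mul_one, one_mul]
  change act χ h⁻¹ (b.coeff _) = act χ h⁻¹ (b.coeff g)
  congr 2
  rw [inv_inv, mul_comm g h⁻¹, mul_inv_cancel_left]

variable {k l : ℕ}

/-- The arguments `f_1, …, f_s, ψ(f_{s+1}, …, f_{s+l}), μ f_{s+l+1}, …, μ f_{k+l-1}`. -/
def twArgs (mu : G) (ψ : (Fin l → Poly n) → Poly n) (s : Fin k) (f : Fin (k + l - 1) → Poly n)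
    (r : Fin k) : Poly n :=
  if h : r < s then f ⟨r, by omega⟩
  else if h' : r = s then ψ fun t => f ⟨s + t, by omega⟩
  else act χ mu (f ⟨r + l - 1, by omega⟩)

theorem twArgs_act (mu h : G) {ψ : (Fin l → Poly n) → Poly n}
    (hψ : ∀ f, ψ (fun r => act χ h (f r)) = act χ h (ψ f)) (s : Fin k)
    (f : Fin (k + l - 1) → Poly n) :
    twArgs χ mu ψ s (fun r => act χ h (f r)) = fun r => act χ h (twArgs χ mu ψ s f r) := by
  funext r
  simp only [twArgs]
  split_ifs
  · rfl
  · rw [hψ]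
  · rw [← AlgHom.comp_apply, ← act_mul, mul_comm, act_mul, AlgHom.comp_apply]

variable [Fintype G]

theorem T2_single {k : ℕ} (Φ : Cochain k (Poly n) (Crossed G n)) (γ : Fin k → G)
    (b : Fin k → Poly n) :
    T2 χ Φ (fun r => single (γ r) (b r)) =
      mulU χ (∏ r, γ r) (Φ fun r => act χ (∏ s ∈ Finset.Iio r, γ s) (b r)) := by
  classical
  simp only [T2, sum_apply, LinearMap.compMultilinearMap_apply, MultilinearMap.compLinearMap_apply,
    LinearMap.comp_apply, coeffAt_single, AlgHom.toLinearMap_apply]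
  rw [Finset.sum_eq_single γ]
  · simp
  · intro γ' _ hne
    obtain ⟨r, hr⟩ := Function.ne_iff.mp hne
    have hz : Φ (fun r => act χ (∏ s ∈ Finset.Iio r, γ' s) (if γ r = γ' r then b r else 0)) = 0 :=
      Φ.map_coord_zero r (by rw [if_neg (Ne.symm hr), map_zero])
    rw [hz, map_zero]
  · exact fun h => absurd (Finset.mem_univ _) h

theorem T1_apply {k : ℕ} (ξ : ∀ g, Sec χ g k) (f : Fin k → Poly n) :
    T1 χ ξ f = ∑ g : G, (single g (T1g χ g k (ξ g) f) : Crossed G n) := by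
  simp [T1, lsingle_apply]

theorem T_single_one {k : ℕ} (ξ : ∀ g, Sec χ g k) (f : Fin k → Poly n) :
    T χ ξ (fun r => single 1 (f r)) = ∑ g : G, (single g (T1g χ g k (ξ g) f) : Crossed G n) := by
  rw [T, T2_single χ (T1 χ ξ) (fun _ => 1) f, Finset.prod_const_one]
  simp only [Finset.prod_const_one, act_one, AlgHom.id_apply, T1_apply, map_sum, mulU_single,
    mul_one]

/-- On polynomial arguments, the component `μ` of the inserted cochain contributes `U_μ`, which is
moved to the right past the remaining arguments and acts on them. -/
theorem T_insertArgs (ξ : ∀ g, Sec χ g k) (η : ∀ g, Sec χ g l) (s : Fin k)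
    (f : Fin (k + l - 1) → Poly n) :
    T χ ξ (insertArgs (T χ η) s fun r => single 1 (f r)) = ∑ mu : G, ∑ lam : G,
      (single (lam * mu) (T1g χ lam k (ξ lam) (twArgs χ mu (T1g χ mu l (η mu)) s f)) :
        Crossed G n) := by
  classical
  let Q : G → Poly n := fun mu => T1g χ mu l (η mu) fun t => f ⟨s + t, by omega⟩
  let b : Fin k → Poly n := fun r =>
    if h : r < s then f ⟨r, by omega⟩ else if h' : r = s then 0 else f ⟨r + l - 1, by omega⟩
  have h1 : (insertArgs (T χ η) s fun r => (single 1 (f r) : Crossed G n)) =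
      Function.update (fun r => single 1 (b r)) s (∑ mu : G, single mu (Q mu)) := by
    funext r
    by_cases hr : r = s
    · subst hr
      rw [Function.update_self]
      simp only [insertArgs, lt_irrefl, dite_false, dite_true]
      exact T_single_one χ η fun t => f ⟨r + t, by omega⟩
    · rw [Function.update_of_ne hr]
      simp only [insertArgs, b, hr, dite_false]
      split_ifs <;> rfl
  rw [h1, MultilinearMap.map_update_sum]
  refine Finset.sum_congr rfl fun mu _ => ?_
  have h2 : (Function.update (fun r => (single 1 (b r) : Crossed G n)) s (single mu (Q mu))) =
      fun r => single (Function.update (fun _ => (1 : G)) s mu r) (Function.update b s (Q mu) r) := by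
    funext r
    by_cases hr : r = s
    · subst hr; simp
    · simp [Function.update_of_ne hr]
  rw [h2, T, T2_single]
  have h3 : ∏ r, Function.update (fun _ => (1 : G)) s mu r = mu := by
    rw [Finset.prod_update_of_mem (Finset.mem_univ _)]; simp
  have h4 : (fun r => act χ (∏ s' ∈ Finset.Iio r, Function.update (fun _ => (1 : G)) s mu s')
      (Function.update b s (Q mu) r)) = twArgs χ mu (T1g χ mu l (η mu)) s f := by
    funext r
    by_cases hrs : s < r
    · rw [Finset.prod_update_of_mem (Finset.mem_Iio.mpr hrs), Function.update_of_ne hrs.ne']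
      simp [twArgs, b, hrs.ne', hrs.not_gt]
    · rw [Finset.prod_update_of_notMem (by simpa using hrs), Finset.prod_const_one, act_one,
        AlgHom.id_apply]
      by_cases hr : r = s
      · subst hr; simp [twArgs, Q]
      · have hlt : r < s := lt_of_le_of_ne (not_lt.mp hrs) hr
        rw [Function.update_of_ne hr]
        simp [twArgs, b, hlt]
  rw [h3, h4, T1_apply, map_sum]
  simp only [mulU_single]

/-- The component at `g` of the pre-Lie product of `T ξ` and `T η`, on polynomial arguments. The sign
`(-1)^{s(l-1)}` is written with `l + 1`, as `l` may be zero. -/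
def preLieComp (ξ : ∀ g, Sec χ g k) (η : ∀ g, Sec χ g l) (g : G)
    (f : Fin (k + l - 1) → Poly n) : Poly n :=
  ∑ mu : G, ∑ s : Fin k, (-1 : ℂ) ^ ((s : ℕ) * (l + 1)) •
    T1g χ (g * mu⁻¹) k (ξ (g * mu⁻¹)) (twArgs χ mu (T1g χ mu l (η mu)) s f)

theorem negOnePow_smul_eq {M : Type*} [AddCommGroup M] [Module ℂ M] (a : ℤ) (b : ℕ)
    (h : Even (a - b)) (x : M) : Int.negOnePow a • x = (-1 : ℂ) ^ b • x := by
  have h1 : Int.negOnePow a = Int.negOnePow b := (Int.negOnePow_eq_iff _ _).mpr h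
  rw [h1, Int.negOnePow_def, zpow_natCast, Units.smul_def, ← Int.cast_smul_eq_zsmul ℂ]
  simp

theorem coeffAt_preLie (ξ : ∀ g, Sec χ g k) (η : ∀ g, Sec χ g l) (g : G)
    (f : Fin (k + l - 1) → Poly n) :
    coeffAt g (preLie (T χ ξ) (T χ η) fun r => (single 1 (f r) : Crossed G n)) =
      preLieComp χ ξ η g f := by
  classical
  have h1 : ∀ s : Fin k, coeffAt g ((Int.negOnePow ((s : ℤ) * ((l : ℤ) - 1)) •
      insertAt (T χ ξ) (T χ η) s) fun r => (single 1 (f r) : Crossed G n)) =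
      ∑ mu : G, (-1 : ℂ) ^ ((s : ℕ) * (l + 1)) •
        T1g χ (g * mu⁻¹) k (ξ (g * mu⁻¹)) (twArgs χ mu (T1g χ mu l (η mu)) s f) := by
    intro s
    have h2 : (Int.negOnePow ((s : ℤ) * ((l : ℤ) - 1)) •
        insertAt (T χ ξ) (T χ η) s) (fun r => (single 1 (f r) : Crossed G n)) =
        Int.negOnePow ((s : ℤ) * ((l : ℤ) - 1)) •
          T χ ξ (insertArgs (T χ η) s fun r => single 1 (f r)) := rfl
    rw [h2, negOnePow_smul_eq _ ((s : ℕ) * (l + 1)) ⟨-(s : ℤ), by push_cast; ring⟩, map_smul,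
      T_insertArgs, map_sum, Finset.smul_sum]
    refine Finset.sum_congr rfl fun mu _ => ?_
    rw [map_sum]
    congr 1
    rw [Finset.sum_eq_single (g * mu⁻¹)]
    · rw [coeffAt_single, if_pos (by simp)]
    · intro lam _ hne
      rw [coeffAt_single, if_neg]
      rintro rfl
      exact hne (by simp)
    · exact fun h => absurd (Finset.mem_univ _) h
  rw [preLie, sum_apply, map_sum, Finset.sum_congr rfl fun s _ => h1 s, Finset.sum_comm]
  rfl

theorem preLieComp_act {ξ : ∀ g, Sec χ g k} {η : ∀ g, Sec χ g l} (hξ : IsGInvariant χ ξ)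
    (hη : IsGInvariant χ η) (g h : G) (f : Fin (k + l - 1) → Poly n) :
    preLieComp χ ξ η g (fun r => act χ h (f r)) = act χ h (preLieComp χ ξ η g f) := by
  simp only [preLieComp, map_sum, map_smul]
  refine Finset.sum_congr rfl fun mu _ => Finset.sum_congr rfl fun s _ => ?_
  rw [twArgs_act χ mu h (fun f => T1g_act χ (hη mu) h f), T1g_act χ (hξ _)]

/-- Averaging over the group does not change the component, by invariance. -/
theorem coeffAt_L1_preLie {ξ : ∀ g, Sec χ g k} {η : ∀ g, Sec χ g l} (hξ : IsGInvariant χ ξ)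
    (hη : IsGInvariant χ η) (g : G) (f : Fin (k + l - 1) → Poly n) :
    ((coeffAt g).compMultilinearMap (L1 χ (preLie (T χ ξ) (T χ η)))) f =
      preLieComp χ ξ η g f := by
  have hG : (Fintype.card G : ℂ) ≠ 0 := by exact_mod_cast Fintype.card_ne_zero
  have h1 : ∀ h : G, coeffAt g (conjU χ h (preLie (T χ ξ) (T χ η)
      fun r => (SkewMonoidAlgebra.single 1 (act χ h (f r)) : Crossed G n))) =
      preLieComp χ ξ η g f := by
    intro h
    rw [coeffAt_conjU, coeffAt_preLie χ ξ η g fun r => act χ h (f r), preLieComp_act χ hξ hη,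
      ← AlgHom.comp_apply, ← act_mul, inv_mul_cancel, act_one, AlgHom.id_apply]
  have h2 : ((coeffAt g).compMultilinearMap (L1 χ (preLie (T χ ξ) (T χ η)))) f =
      (Fintype.card G : ℂ)⁻¹ • ∑ h : G, coeffAt g (conjU χ h (preLie (T χ ξ) (T χ η)
        fun r => (SkewMonoidAlgebra.single 1 (act χ h (f r)) : Crossed G n))) := by
    simp only [L1, LinearMap.compMultilinearMap_apply, smul_apply, sum_apply, map_smul, map_sum]
    rfl
  rw [h2, Finset.sum_congr rfl fun h _ => h1 h, Finset.sum_const, Finset.card_univ,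
    ← Nat.cast_smul_eq_nsmul ℂ, smul_smul, inv_mul_cancel₀ hG, one_smul]

end PreLie

/-! ### Normalization -/

section Normalized

variable {G : Type*} [CommGroup G] {n : ℕ} (χ : Fin n → G →* ℂˣ) {k l : ℕ}

theorem isNormalized_T1g (g : G) (ξ : MVFix χ g) : IsNormalized (T1g χ g k ξ) := by
  intro f c
  rcases lt_or_ge k (codim χ g) with hk | hk
  · simp [T1g_eq_zero_of_lt χ hk]
  · simp only [T1g_apply χ (Nat.sub_add_cancel hk), map_add, slotOp_C, add_zero]

theorem isNormalized_comp_twArgs (mu : G) {φ : (Fin k → Poly n) → Poly n}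
    {ψ : (Fin l → Poly n) → Poly n} (hφ : IsNormalized φ) (hψ : IsNormalized ψ) (s : Fin k) :
    IsNormalized fun f : Fin (k + l - 1) → Poly n => φ (twArgs χ mu ψ s f) := by
  intro f c
  let c' : Fin k → ℂ := fun r =>
    if h : r < s then c ⟨r, by omega⟩ else if h' : r = s then 0 else c ⟨r + l - 1, by omega⟩
  have : twArgs χ mu ψ s (fun r => f r + C (c r)) = fun r => twArgs χ mu ψ s f r + C (c' r) := by
    funext r
    simp only [twArgs, c']
    split_ifs with h1 h2
    · rfl
    · rw [hψ (fun t => f ⟨s + t, by omega⟩) fun t => c ⟨s + t, by omega⟩]; simp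
    · simp [act]
  change φ _ = φ _
  rw [this, hφ]

variable [Fintype G]

theorem isNormalized_preLieComp (ξ : ∀ g, Sec χ g k) (η : ∀ g, Sec χ g l) (g : G) :
    IsNormalized (preLieComp χ ξ η g) := by
  intro f c
  simp only [preLieComp]
  refine Finset.sum_congr rfl fun mu _ => Finset.sum_congr rfl fun s _ => ?_
  congr 1
  exact isNormalized_comp_twArgs χ mu (isNormalized_T1g χ _ _) (isNormalized_T1g χ _ _) s f c

/-- All the operators in the slots annihilate constants, so `L` evaluates the pre-Lie product on the
coordinate functions. -/
theorem coe_L_preLie {ξ : ∀ g, Sec χ g k} {η : ∀ g, Sec χ g l} (hξ : IsGInvariant χ ξ)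
    (hη : IsGInvariant χ η) (g : G) :
    (L χ (preLie (T χ ξ) (T χ η)) g : MVFix χ g) =
      TensorProduct.map (restrictFn χ g).toLinearMap (projSec χ g (k + l - 1))
        (∑ j : Fin (k + l - 1) → Fin n,
          preLieComp χ ξ η g (fun r => X (j r)) ⊗ₜ[ℂ] wedge (List.ofFn j)) := by
  have hn : IsNormalized ((coeffAt g).compMultilinearMap (L1 χ (preLie (T χ ξ) (T χ η)))) := by
    intro f c
    rw [coeffAt_L1_preLie χ hξ hη, coeffAt_L1_preLie χ hξ hη]
    exact isNormalized_preLieComp χ ξ η g f c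
  rw [L, coe_L3, L2_eq_sum_atPoint]
  simp only [atPoint_eq_of_isNormalized hn, coeffAt_L1_preLie χ hξ hη]

end Normalized

/-! ### The symbol of an insertion -/

section Symbol

variable {G : Type*} [CommGroup G] {n : ℕ} (χ : Fin n → G →* ℂˣ) {k l : ℕ}

/-- `ω ↦ ∂_A ∧ ω ∧ ∂_B` for lists `A`, `B` of indices. -/
def sandwich (A B : List (Fin n)) : Ext n →ₗ[ℂ] Ext n :=
  LinearMap.mulRight ℂ (wedge B) ∘ₗ LinearMap.mulLeft ℂ (wedge A)

theorem sandwich_apply (A B : List (Fin n)) (e : Ext n) :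
    sandwich A B e = wedge A * e * wedge B := rfl

theorem sum_append {α M : Type*} [Fintype α] [AddCommMonoid M] {a b : ℕ}
    (F : (Fin (a + b) → α) → M) : ∑ j, F j = ∑ x, ∑ y, F (Fin.append x y) := by
  rw [← Fintype.sum_prod_type' (f := fun x y => F (Fin.append x y))]
  exact (Fintype.sum_equiv (Fin.appendEquiv a b) _ _ fun _ => rfl).symm

/-- If `D_r` differentiates in the direction `w_r`, only the words `j` that agree with `w` outside
of the inserted block contribute to the symbol of an insertion into `D_1 ⊗ … ⊗ D_k`. -/
theorem sum_prod_twArgs (mu : G) (Ψ : Cochain l (Poly n) (Poly n)) (s : Fin k)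
    (D : Fin k → (Poly n →ₗ[ℂ] Poly n)) (w : Fin k → Fin n)
    (hD : ∀ r i, D r (X i) = if i = w r then 1 else 0) :
    ∃ A B : List (Fin n), List.ofFn w = A ++ w s :: B ∧ A.length = s ∧
      ∑ j : Fin (k + l - 1) → Fin n,
        (∏ r, D r (twArgs χ mu Ψ s (fun r => X (j r)) r)) ⊗ₜ[ℂ] wedge (List.ofFn j) =
      (B.map fun i => (χ i mu : ℂ)).prod • TensorProduct.map (D s) (sandwich A B)
        (∑ b : Fin l → Fin n, Ψ (fun r => X (b r)) ⊗ₜ[ℂ] wedge (List.ofFn b)) := by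
  obtain ⟨s, hs⟩ := s
  obtain ⟨r, rfl⟩ : ∃ r, k = s + 1 + r := ⟨k - (s + 1), by omega⟩
  set a₀ : Fin s → Fin n := fun i => w (Fin.castAdd r (Fin.castAdd 1 i)) with ha₀
  set c₀ : Fin r → Fin n := fun i => w (Fin.natAdd (s + 1) i) with hc₀
  have hw : w = Fin.append (Fin.append a₀ fun _ : Fin 1 => w ⟨s, hs⟩) c₀ := by
    funext i
    refine Fin.addCases (fun i => ?_) (fun i => ?_) i
    · rw [Fin.append_left]
      refine Fin.addCases (fun i => ?_) (fun i => ?_) i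
      · rw [Fin.append_left]
      · rw [Fin.append_right]
        congr 1
        ext; simp
    · rw [Fin.append_right]
  refine ⟨List.ofFn a₀, List.ofFn c₀, ?_, by simp, ?_⟩
  · conv_lhs => rw [hw]
    rw [List.ofFn_fin_append, List.ofFn_fin_append]
    simp
  have hN : s + l + r = s + 1 + r + l - 1 := by omega
  rw [← Fintype.sum_equiv (Equiv.arrowCongr (finCongr hN) (Equiv.refl (Fin n)))
    (fun j : Fin (s + l + r) → Fin n => (∏ i, D i (twArgs χ mu Ψ ⟨s, hs⟩
      (fun i => X (j (Fin.cast hN.symm i))) i)) ⊗ₜ[ℂ] wedge (List.ofFn j)) _ ?_]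
  swap
  · intro j
    have : List.ofFn j =
        List.ofFn ((Equiv.arrowCongr (finCongr hN) (Equiv.refl (Fin n))) j) := by
      refine List.ext_getElem (by simp [hN]) fun i h1 h2 => ?_
      rw [List.getElem_ofFn, List.getElem_ofFn]; rfl
    rw [this]; rfl
  rw [sum_append]
  simp only [sum_append (a := s) (b := l)]
  have hprod : ∀ (a : Fin s → Fin n) (b : Fin l → Fin n) (c : Fin r → Fin n),
      ∏ i, D i (twArgs χ mu Ψ ⟨s, hs⟩ (fun i => X (Fin.append (Fin.append a b) c
        (Fin.cast hN.symm i))) i) =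
      if a = a₀ then if c = c₀ then ((List.ofFn c₀).map fun i => (χ i mu : ℂ)).prod •
        D ⟨s, hs⟩ (Ψ fun i => X (b i)) else 0 else 0 := by
    intro a b c
    rw [Fin.prod_univ_add, Fin.prod_univ_add, Fin.prod_univ_one]
    have h1 : ∀ i : Fin s, D (Fin.castAdd r (Fin.castAdd 1 i)) (twArgs χ mu Ψ ⟨s, hs⟩
        (fun i => X (Fin.append (Fin.append a b) c (Fin.cast hN.symm i)))
          (Fin.castAdd r (Fin.castAdd 1 i))) = if a i = a₀ i then 1 else 0 := by
      intro i
      rw [twArgs, dif_pos (by simp [Fin.lt_def])]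
      have : (Fin.cast hN.symm ⟨i, by omega⟩ : Fin (s + l + r)) =
          Fin.castAdd r (Fin.castAdd l i) := rfl
      simp only [Fin.val_castAdd, this, Fin.append_left, hD, ha₀]
    have h2 : D (Fin.castAdd r (Fin.natAdd s 0)) (twArgs χ mu Ψ ⟨s, hs⟩
        (fun i => X (Fin.append (Fin.append a b) c (Fin.cast hN.symm i)))
          (Fin.castAdd r (Fin.natAdd s 0))) = D ⟨s, hs⟩ (Ψ fun i => X (b i)) := by
      have h3 : (Fin.castAdd r (Fin.natAdd s 0) : Fin (s + 1 + r)) = ⟨s, hs⟩ := rfl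
      rw [h3, twArgs, dif_neg (lt_irrefl _), dif_pos rfl]
      congr 2
      funext i
      have : (Fin.cast hN.symm ⟨s + i, by omega⟩ : Fin (s + l + r)) =
          Fin.castAdd r (Fin.natAdd s i) := rfl
      simp only [this, Fin.append_left, Fin.append_right]
    have h4 : ∀ i : Fin r, D (Fin.natAdd (s + 1) i) (twArgs χ mu Ψ ⟨s, hs⟩
        (fun i => X (Fin.append (Fin.append a b) c (Fin.cast hN.symm i)))
          (Fin.natAdd (s + 1) i)) = (χ (c i) mu : ℂ) • if c i = c₀ i then 1 else 0 := by
      intro i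
      rw [twArgs, dif_neg (by simp [Fin.lt_def]; omega), dif_neg (by simp [Fin.ext_iff]; omega)]
      have : (Fin.cast hN.symm ⟨s + 1 + i + l - 1, by omega⟩ : Fin (s + l + r)) =
          Fin.natAdd (s + l) i := by ext; simp; omega
      have hact : ∀ q : Fin n, act χ mu (X q) = (χ q mu : ℂ) • (X q : Poly n) := fun q => by
        simp [act, smul_eq_C_mul]
      simp only [Fin.val_natAdd, this, Fin.append_right, hact, map_smul, hD, hc₀]
    simp only [h1, h2, h4, Finset.prod_boole]
    by_cases ha : a = a₀
    · by_cases hc : c = c₀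
      · subst ha hc
        rw [List.map_ofFn, List.prod_ofFn, if_pos rfl, if_pos rfl]
        simp [smul_eq_C_mul, mul_comm]
      · obtain ⟨i, hi⟩ := Function.ne_iff.mp hc
        rw [if_pos ha, if_neg hc, Finset.prod_eq_zero (Finset.mem_univ i), mul_zero]
        rw [if_neg hi, smul_zero]
    · rw [if_neg ha, if_neg, zero_mul, zero_mul]
      exact fun h => ha (funext fun i => h i (Finset.mem_univ i))
  simp only [hprod, ite_tmul, List.ofFn_fin_append, wedge_append]
  rw [Finset.sum_eq_single a₀ (fun a _ ha => by simp [ha]) (fun h => absurd (Finset.mem_univ _) h),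
    map_sum, Finset.smul_sum]
  refine Finset.sum_congr rfl fun b _ => ?_
  rw [Finset.sum_eq_single c₀ (fun c _ hc => by simp [hc]) (fun h => absurd (Finset.mem_univ _) h),
    if_pos rfl, if_pos rfl, TensorProduct.map_tmul, sandwich_apply, TensorProduct.smul_tmul']

variable {mu : G}

/-- The factors `χ_i(μ)` from the twist by `μ` disappear next to `Λ_μ`: either all `∂_i` in `∂_B` are
tangent to `V^μ`, and the factors are `1`, or `∂_B ∧ Λ_μ = 0`. -/
theorem prod_smul_map_sandwich {θ : MVFix χ mu} (hθ : θ ∈ Sec χ mu l)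
    (D : Poly n →ₗ[ℂ] Poly n) (A B : List (Fin n)) :
    (B.map fun i => (χ i mu : ℂ)).prod •
        TensorProduct.map D (sandwich A B) (extSec χ mu θ) =
      (-1 : ℂ) ^ (l * B.length) •
        ((1 : Poly n) ⊗ₜ[ℂ] wedge (A ++ B) * D.rTensor (Ext n) (extSec χ mu θ)) := by
  induction hθ using Submodule.span_induction with
  | zero => simp
  | add x y _ _ hx hy => simp only [map_add, smul_add, mul_add, hx, hy]
  | smul c x _ hx =>
    simp only [map_smul, mul_smul_comm]
    rw [smul_comm, hx, smul_comm]
  | mem x hx =>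
    obtain ⟨J, p, hJ, hl, rfl⟩ := hx
    have hlen : (J.sort ++ (normal χ mu).sort).length = l := by
      rw [List.length_append, length_sort_normal, Finset.length_sort, hl]
    have hcomm := wedge_mul_comm (J.sort ++ (normal χ mu).sort) B
    rw [Lam_eq, ← wedge_append, extSec, LinearMap.rTensor_tmul, TensorProduct.map_tmul,
      LinearMap.rTensor_tmul, Algebra.TensorProduct.tmul_mul_tmul, one_mul, sandwich_apply,
      mul_assoc, wedge_append A B, mul_assoc, hcomm, hlen, mul_smul_comm,
      ← TensorProduct.tmul_smul, ← TensorProduct.tmul_smul, smul_comm]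
    by_cases hB : ∀ i ∈ B, i ∈ tang χ mu
    · have : (B.map fun i => (χ i mu : ℂ)).prod = 1 := by
        refine List.prod_eq_one fun c hc => ?_
        obtain ⟨i, hi, rfl⟩ := List.mem_map.mp hc
        rw [(mem_tang χ).mp (hB i hi), Units.val_one]
      rw [this, one_smul]
    · push Not at hB
      obtain ⟨i, hi, hi'⟩ := hB
      have hi2 : i ∈ normal χ mu := by
        by_contra h; exact hi' ((mem_tang_iff_notMem_normal χ).mpr h)
      rw [wedge_mul_eq_zero (i := i) hi (by simp [hi2])]
      simp

variable {lam : G} {m : ℕ}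

/-- Evaluation on coordinate functions recovers the symbol. -/
theorem sum_T1g_X_tmul_wedge {g : G} {η : MVFix χ g} (hη : η ∈ Sec χ g l) :
    ∑ b : Fin l → Fin n, T1g χ g l η (fun r => X (b r)) ⊗ₜ[ℂ] wedge (List.ofFn b) =
      extSec χ g η := by
  rcases lt_or_ge l (codim χ g) with hl | hl
  · rw [eq_zero_of_mem_Sec_of_lt χ hl hη, T1g_eq_zero_of_lt χ hl]
    simp
  have hl' := Nat.sub_add_cancel hl
  rw [← sum_slotCoeff_tmul_wedge χ hl' hη]
  simp only [T1g_apply χ hl', TensorProduct.sum_tmul]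
  rw [Finset.sum_comm]
  refine Finset.sum_congr rfl fun t _ => ?_
  rw [Finset.sum_comm]
  refine Finset.sum_congr rfl fun σ _ => ?_
  rw [Finset.sum_eq_single (word χ hl' t σ)]
  · simp [slotOp_X]
  · intro b _ hb
    obtain ⟨r, hr⟩ := Function.ne_iff.mp hb
    rw [Finset.prod_eq_zero (Finset.mem_univ r), mul_zero, TensorProduct.zero_tmul]
    rw [slotOp_X, if_neg hr]
  · exact fun h => absurd (Finset.mem_univ _) h

/-- The symbol of the insertion of `T_1^μ η` into the `s`-th slot of `T_1^λ ξ`. -/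
theorem sum_insertion (h : m + codim χ lam = k) (ξ : MVFix χ lam) {η : MVFix χ mu}
    (hη : η ∈ Sec χ mu l) (s : Fin k) :
    ∑ j : Fin (k + l - 1) → Fin n,
      T1g χ lam k ξ (twArgs χ mu (T1g χ mu l η) s fun r => X (j r)) ⊗ₜ[ℂ] wedge (List.ofFn j) =
    (-1 : ℂ) ^ (l * (k - 1 - s)) • ∑ t : Fin m → {i // i ∈ tang χ lam},
      ∑ σ : Equiv.Perm (Fin (codim χ lam)),
        slotCoeff χ lam t σ ξ ⊗ₜ[ℂ] wedge ((List.ofFn (word χ h t σ)).eraseIdx s) *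
          (slotOp χ h t σ s).rTensor (Ext n) (extSec χ mu η) := by
  simp only [T1g_apply χ h, TensorProduct.sum_tmul, Finset.smul_sum]
  rw [Finset.sum_comm]
  refine Finset.sum_congr rfl fun t _ => ?_
  rw [Finset.sum_comm]
  refine Finset.sum_congr rfl fun σ _ => ?_
  obtain ⟨A, B, hAB, hA, hsum⟩ := sum_prod_twArgs χ mu (T1g χ mu l η) s (slotOp χ h t σ)
    (word χ h t σ) (slotOp_X χ h t σ)
  have hB : B.length = k - 1 - s := by
    have := congrArg List.length hAB
    simp only [List.length_ofFn, List.length_append, List.length_cons] at this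
    omega
  rw [sum_T1g_X_tmul_wedge χ hη, prod_smul_map_sandwich χ hη] at hsum
  have herase : (List.ofFn (word χ h t σ)).eraseIdx s = A ++ B := by
    rw [hAB, List.eraseIdx_append_of_length_le hA.le, hA, Nat.sub_self, List.eraseIdx_cons_zero]
  have h1 : ∀ (a : Poly n) (e : Ext n), (slotCoeff χ lam t σ ξ * a) ⊗ₜ[ℂ] e =
      slotCoeff χ lam t σ ξ ⊗ₜ[ℂ] (1 : Ext n) * a ⊗ₜ[ℂ] e := fun a e => by
    rw [Algebra.TensorProduct.tmul_mul_tmul, one_mul]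
  simp only [h1]
  rw [← Finset.mul_sum, hsum, mul_smul_comm, ← mul_assoc, Algebra.TensorProduct.tmul_mul_tmul,
    mul_one, one_mul, hB, herase]

/-- If `λ` and `μ` move a common coordinate, the symbols of all insertions vanish: either `∂_i`
occurs twice, or a function that does not depend on `x^i` is differentiated along `x^i`. -/
theorem mul_rTensor_slotOp_eq_zero (h : m + codim χ lam = k) {i : Fin n}
    (hi : i ∈ normal χ lam) (hi' : i ∈ normal χ mu) {η : MVFix χ mu} (hη : η ∈ Sec χ mu l)
    (s : Fin k) (t : Fin m → {i // i ∈ tang χ lam}) (σ : Equiv.Perm (Fin (codim χ lam)))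
    (c : Poly n) :
    c ⊗ₜ[ℂ] wedge ((List.ofFn (word χ h t σ)).eraseIdx s) *
      (slotOp χ h t σ s).rTensor (Ext n) (extSec χ mu η) = 0 := by
  induction hη using Submodule.span_induction with
  | zero => simp
  | add x y _ _ hx hy => rw [map_add, map_add, mul_add, hx, hy, add_zero]
  | smul c x _ hx => rw [map_smul, map_smul, mul_smul_comm, hx, smul_zero]
  | mem x hx =>
    obtain ⟨J, p, hJ, hl, rfl⟩ := hx
    rw [Lam_eq, ← wedge_append, extSec, LinearMap.rTensor_tmul, LinearMap.rTensor_tmul,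
      Algebra.TensorProduct.tmul_mul_tmul, AlgHom.toLinearMap_apply]
    obtain ⟨r, hr⟩ := exists_word_eq χ h t σ hi
    by_cases hrs : r = s
    · subst hrs
      rw [slotOp_extendFn_of_mem_normal χ h t σ r (hr ▸ hi'), mul_zero, TensorProduct.zero_tmul]
    · rw [wedge_mul_eq_zero (i := i) _ (by simp [hi']), TensorProduct.tmul_zero]
      rw [List.mem_eraseIdx_iff_getElem]
      exact ⟨r, by simp, fun h' => hrs (Fin.ext h'), by simp [hr]⟩

/-- The bracket `(ω, θ) ↦ ∑_q (ι_{dx^q} ω) ∧ ∂_q θ` of multivector fields. -/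
def bracket : Poly n ⊗[ℂ] Ext n →ₗ[ℂ] Poly n ⊗[ℂ] Ext n →ₗ[ℂ] Poly n ⊗[ℂ] Ext n :=
  ∑ q, (LinearMap.mul ℂ (Poly n ⊗[ℂ] Ext n)).compl₁₂ ((contr q).lTensor (Poly n))
    ((pderiv (R := ℂ) q).toLinearMap.rTensor (Ext n))

theorem bracket_apply (ω θ : Poly n ⊗[ℂ] Ext n) :
    bracket ω θ = ∑ q, (contr q).lTensor (Poly n) ω *
      (pderiv (R := ℂ) q).toLinearMap.rTensor (Ext n) θ := by
  simp [bracket]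

theorem bracket_tmul_wedge (c : Poly n) {k : ℕ} (w : Fin k → Fin n) (θ : Poly n ⊗[ℂ] Ext n) :
    bracket (c ⊗ₜ[ℂ] wedge (List.ofFn w)) θ = ∑ s : Fin k, (-1 : ℂ) ^ (s : ℕ) •
      (c ⊗ₜ[ℂ] wedge ((List.ofFn w).eraseIdx s) *
        (pderiv (R := ℂ) (w s)).toLinearMap.rTensor (Ext n) θ) := by
  simp only [bracket_apply, LinearMap.lTensor_tmul, contr_wedge, TensorProduct.tmul_sum,
    Finset.sum_mul]
  rw [Finset.sum_comm]
  refine Fintype.sum_equiv (finCongr (by simp)) _ _ fun z => ?_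
  rw [Finset.sum_eq_single ((List.ofFn w).get z)]
  · rw [if_pos rfl, TensorProduct.tmul_smul, smul_mul_assoc]
    simp
    rfl
  · intro q _ hq
    rw [if_neg (Ne.symm hq), zero_smul, TensorProduct.tmul_zero, zero_mul]
  · exact fun h => absurd (Finset.mem_univ _) h

/-- Restriction to `V^g` of multivector fields on `V`. -/
def restrictMV (g : G) : Poly n ⊗[ℂ] Ext n →ₐ[ℂ] MVFix χ g :=
  Algebra.TensorProduct.map (restrictFn χ g) (AlgHom.id ℂ (Ext n))

theorem restrictMV_tmul (g : G) (p : Poly n) (e : Ext n) :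
    restrictMV χ g (p ⊗ₜ[ℂ] e) = restrictFn χ g p ⊗ₜ[ℂ] e := rfl

theorem map_restrictFn_projSec (g : G) (N : ℕ) (ω : Poly n ⊗[ℂ] Ext n) :
    TensorProduct.map (restrictFn χ g).toLinearMap (projSec χ g N) ω =
      (projSec χ g N).lTensor (PolyFix χ g) (restrictMV χ g ω) := by
  induction ω using TensorProduct.induction_on with
  | zero => simp
  | tmul p e => rfl
  | add a b ha hb => simp only [map_add, ha, hb]

theorem restrictMV_rTensor_slotOp (h : m + codim χ lam = k) {g : G}
    (hg : normal χ lam ⊆ normal χ g) (t : Fin m → {i // i ∈ tang χ lam})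
    (σ : Equiv.Perm (Fin (codim χ lam))) (s : Fin k) (θ : Poly n ⊗[ℂ] Ext n) :
    restrictMV χ g ((slotOp χ h t σ s).rTensor (Ext n) θ) =
      restrictMV χ g
        ((pderiv (R := ℂ) (word χ h t σ s)).toLinearMap.rTensor (Ext n) θ) := by
  induction θ using TensorProduct.induction_on with
  | zero => simp
  | tmul p e =>
    rw [LinearMap.rTensor_tmul, LinearMap.rTensor_tmul, restrictMV_tmul, restrictMV_tmul,
      restrictFn_slotOp χ h t σ hg]
    rfl
  | add a b ha hb => simp only [map_add, ha, hb]

/-- The signed sum of the symbols of all insertions of `T_1^μ η` into `T_1^λ ξ`. -/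
def insertionSymbol (lam mu : G) (k l : ℕ) (ξ : MVFix χ lam) (η : MVFix χ mu) :
    Poly n ⊗[ℂ] Ext n :=
  ∑ s : Fin k, (-1 : ℂ) ^ ((s : ℕ) * (l + 1)) • ∑ j : Fin (k + l - 1) → Fin n,
    T1g χ lam k ξ (twArgs χ mu (T1g χ mu l η) s fun r => X (j r)) ⊗ₜ[ℂ] wedge (List.ofFn j)

theorem insertionSymbol_eq (h : m + codim χ lam = k) (ξ : MVFix χ lam) {η : MVFix χ mu}
    (hη : η ∈ Sec χ mu l) :
    insertionSymbol χ lam mu k l ξ η = (-1 : ℂ) ^ (l * (k - 1)) •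
      ∑ t : Fin m → {i // i ∈ tang χ lam}, ∑ σ : Equiv.Perm (Fin (codim χ lam)),
      ∑ s : Fin k, (-1 : ℂ) ^ (s : ℕ) •
        (slotCoeff χ lam t σ ξ ⊗ₜ[ℂ] wedge ((List.ofFn (word χ h t σ)).eraseIdx s) *
          (slotOp χ h t σ s).rTensor (Ext n) (extSec χ mu η)) := by
  have h1 : ∀ s : Fin k, (-1 : ℂ) ^ ((s : ℕ) * (l + 1)) * (-1 : ℂ) ^ (l * (k - 1 - s)) =
      (-1 : ℂ) ^ (l * (k - 1)) * (-1 : ℂ) ^ (s : ℕ) := by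
    intro s
    rw [← pow_add, ← pow_add]
    congr 1
    obtain ⟨r, hr⟩ : ∃ r, k - 1 = r + s := ⟨k - 1 - s, by omega⟩
    rw [hr, Nat.add_sub_cancel]; ring
  simp only [insertionSymbol, sum_insertion χ h ξ hη, smul_smul, h1]
  simp only [mul_smul, ← Finset.smul_sum]
  congr 1
  simp only [Finset.smul_sum]
  rw [Finset.sum_comm]
  refine Finset.sum_congr rfl fun t _ => ?_
  rw [Finset.sum_comm]

theorem insertionSymbol_eq_zero {ξ : MVFix χ lam} {η : MVFix χ mu} (hη : η ∈ Sec χ mu l)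
    {i : Fin n} (hi : i ∈ normal χ lam) (hi' : i ∈ normal χ mu) :
    insertionSymbol χ lam mu k l ξ η = 0 := by
  rcases lt_or_ge k (codim χ lam) with hk | hk
  · simp [insertionSymbol, T1g_eq_zero_of_lt χ hk]
  · rw [insertionSymbol_eq χ (Nat.sub_add_cancel hk) ξ hη]
    simp only [mul_rTensor_slotOp_eq_zero χ _ hi hi' hη, smul_zero, Finset.sum_const_zero]

/-- On a fixed space on which all the coordinates moved by `λ` vanish, the symbol of the insertions
is the bracket. -/
theorem restrictMV_insertionSymbol {g : G} (hg : normal χ lam ⊆ normal χ g) {ξ : MVFix χ lam}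
    (hξ : ξ ∈ Sec χ lam k) {η : MVFix χ mu} (hη : η ∈ Sec χ mu l) :
    restrictMV χ g (insertionSymbol χ lam mu k l ξ η) =
      restrictMV χ g ((-1 : ℂ) ^ (l * (k - 1)) • bracket (extSec χ lam ξ) (extSec χ mu η)) := by
  rcases lt_or_ge k (codim χ lam) with hk | hk
  · rw [eq_zero_of_mem_Sec_of_lt χ hk hξ]
    simp [insertionSymbol, T1g_eq_zero_of_lt χ hk]
  · have hk' := Nat.sub_add_cancel hk
    rw [insertionSymbol_eq χ hk' ξ hη, ← sum_slotCoeff_tmul_wedge χ hk' hξ]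
    simp only [map_sum, LinearMap.sum_apply, bracket_tmul_wedge, map_smul, map_mul,
      restrictMV_rTensor_slotOp χ hk' hg]

end Symbol

/-! ### The bracket in terms of coefficients -/

section Formula

variable {G : Type*} [CommGroup G] {n : ℕ} (χ : Fin n → G →* ℂˣ) {g lam mu : G} {k l : ℕ}

theorem extCoeff_sort_append_normal {I I' : Finset (Fin n)} (hI : I ⊆ tang χ g)
    (hI' : I' ⊆ tang χ g) :
    extCoeff (I'.sort ++ (normal χ g).sort) (wedge I.sort * Lam χ g) =
      if I' = I then 1 else 0 := by
  rw [Lam_eq, ← wedge_append]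
  split_ifs with h
  · subst h
    exact extCoeff_wedge_self (nodup_sort_append_normal χ hI)
  · by_contra h0
    have hp := perm_of_extCoeff_wedge_ne_zero (nodup_sort_append_normal χ hI') h0
    have hp' := (List.perm_append_right_iff _).mp hp
    exact h (Finset.ext fun i => by simpa using hp'.mem_iff (a := i))

theorem coeffX_basis {I I' : Finset (Fin n)} (hI : I ⊆ tang χ g) (hI' : I' ⊆ tang χ g)
    (p : PolyFix χ g) :
    coeffX χ g I'.sort (p ⊗ₜ[ℂ] (wedge I.sort * Lam χ g)) = if I' = I then p else 0 := by
  rw [coeffX_tmul, extCoeff_sort_append_normal χ hI hI']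
  split_ifs <;> simp

/-- The part of the bracket in which `X` is contracted, for sections with a single coefficient. -/
theorem tangentialTerm_basis (hg : ∀ i, i ∈ normal χ g ↔ i ∈ normal χ lam ∨ i ∈ normal χ mu)
    {I J : Finset (Fin n)} (hI : I ⊆ tang χ lam) (hJ : J ⊆ tang χ mu)
    (hk : I.card + codim χ lam = k) (hl : J.card + codim χ mu = l)
    (f : PolyFix χ lam) (h : PolyFix χ mu) :
    tangentialTerm χ g lam mu k l (f ⊗ₜ[ℂ] (wedge I.sort * Lam χ lam))
        (h ⊗ₜ[ℂ] (wedge J.sort * Lam χ mu)) =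
      (-1 : ℂ) ^ (l * (k - 1)) • ∑ q,
        restrictFn χ g (extendFn χ lam f * pderiv q (extendFn χ mu h)) ⊗ₜ[ℂ]
          projSec χ g (k + l - 1)
            (contr q (wedge I.sort) * Lam χ lam * (wedge J.sort * Lam χ mu)) := by
  have htang : ∀ i, i ∈ tang χ g ↔ i ∈ tang χ lam ∧ i ∈ tang χ mu := fun i => by
    simp only [mem_tang_iff_notMem_normal, hg]; tauto
  have hlenI : I.sort.length = I.card := Finset.length_sort _
  have hlenJ : J.sort.length = J.card := Finset.length_sort _
  have hcomm := wedge_mul_comm (normal χ lam).sort J.sort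
  rw [length_sort_normal, hlenJ] at hcomm
  -- the right hand side, expanded along `∂_I`
  have hR : ∑ q, restrictFn χ g (extendFn χ lam f * pderiv q (extendFn χ mu h)) ⊗ₜ[ℂ]
      projSec χ g (k + l - 1)
        (contr q (wedge I.sort) * Lam χ lam * (wedge J.sort * Lam χ mu)) =
      ∑ z : Fin I.sort.length, (-1 : ℂ) ^ ((z : ℕ) + codim χ lam * J.card) •
        (restrictFn χ g (extendFn χ lam f * pderiv (I.sort.get z) (extendFn χ mu h)) ⊗ₜ[ℂ]
          (wedge (I.sort.eraseIdx z) * wedge J.sort * Lam χ lam * Lam χ mu)) := by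
    simp only [contr_wedge, Finset.sum_mul, map_sum, TensorProduct.tmul_sum]
    rw [Finset.sum_comm]
    refine Finset.sum_congr rfl fun z _ => ?_
    rw [Finset.sum_eq_single (I.sort.get z)]
    · have h1 : wedge (I.sort.eraseIdx z) * Lam χ lam * (wedge J.sort * Lam χ mu) =
          wedge (I.sort.eraseIdx z ++ (normal χ lam).sort ++ (J.sort ++ (normal χ mu).sort)) := by
        simp only [wedge_append, Lam_eq]
      have h2 : projSec χ g (k + l - 1)
          (wedge (I.sort.eraseIdx z) * Lam χ lam * (wedge J.sort * Lam χ mu)) =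
          (-1 : ℂ) ^ (codim χ lam * J.card) •
            (wedge (I.sort.eraseIdx z) * wedge J.sort * Lam χ lam * Lam χ mu) := by
        rw [h1, projSec_wedge_of_forall_mem χ]
        · simp only [wedge_append, Lam_eq]
          have hassoc : ∀ a b c d : Ext n, a * b * (c * d) = a * (b * c) * d := by
            intros; simp only [mul_assoc]
          rw [hassoc, hcomm]
          simp only [smul_mul_assoc, mul_smul_comm, mul_assoc]
        · have := z.2
          have h0 : ∀ g, (normal χ g).card = codim χ g := fun _ => rfl
          simp only [List.length_append, List.length_eraseIdx, Finset.length_sort, h0] at this ⊢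
          rw [if_pos this]
          omega
        · intro i hi
          rcases (hg i).mp hi with hi | hi <;> simp [hi]
      rw [if_pos rfl, smul_mul_assoc, smul_mul_assoc, map_smul, h2, smul_smul, ← pow_add,
        TensorProduct.tmul_smul]
    · intro q _ hq
      rw [if_neg (Ne.symm hq), zero_smul, zero_mul, zero_mul, map_zero, TensorProduct.tmul_zero]
    · exact fun h => absurd (Finset.mem_univ _) h
  rw [hR]
  by_cases hIJ : I ⊆ tang χ g ∧ J ⊆ tang χ g
  · obtain ⟨hIg, hJg⟩ := hIJ
    rw [tangentialTerm, Finset.sum_eq_single_of_mem I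
      (Finset.mem_powersetCard.mpr ⟨hIg, by omega⟩), Finset.sum_eq_single_of_mem J
      (Finset.mem_powersetCard.mpr ⟨hJg, by omega⟩), Finset.smul_sum]
    · refine Finset.sum_congr rfl fun z _ => ?_
      have hz := z.2
      rw [coeffX_basis χ hI hI, coeffX_basis χ hJ hJ, if_pos rfl, if_pos rfl, smul_smul, ← pow_add]
      refine negOnePow_smul_eq _ _ ⟨-(z : ℤ), ?_⟩ _
      have hk1 : ((k - 1 : ℕ) : ℤ) = k - 1 := by omega
      have hJ' : (J.card : ℤ) = l - codim χ mu := by omega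
      push_cast [hk1, hJ']
      ring
    · intro J' hJ' hne
      have hJ't : J' ⊆ tang χ mu := fun i hi =>
        ((htang i).mp ((Finset.mem_powersetCard.mp hJ').1 hi)).2
      simp [coeffX_basis χ hJ hJ't, hne]
    · intro I' hI' hne
      have hI't : I' ⊆ tang χ lam := fun i hi =>
        ((htang i).mp ((Finset.mem_powersetCard.mp hI').1 hi)).1
      simp [coeffX_basis χ hI hI't, hne]
  · -- both sides vanish if one of `∂_I`, `∂_J` is not tangent to `V^g`
    trans (0 : MVFix χ g)
    · rw [tangentialTerm]
      refine Finset.sum_eq_zero fun I' hI' => Finset.sum_eq_zero fun J' hJ' =>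
        Finset.sum_eq_zero fun z _ => ?_
      have hI'g := (Finset.mem_powersetCard.mp hI').1
      have hJ'g := (Finset.mem_powersetCard.mp hJ').1
      rw [coeffX_basis χ hI fun i hi => ((htang i).mp (hI'g hi)).1,
        coeffX_basis χ hJ fun i hi => ((htang i).mp (hJ'g hi)).2]
      by_cases h1 : I' = I
      · by_cases h2 : J' = J
        · exact absurd ⟨h1 ▸ hI'g, h2 ▸ hJ'g⟩ hIJ
        · simp [h2]
      · simp [h1]
    · symm
      rw [Finset.sum_eq_zero, smul_zero]
      intro z _
      rw [not_and_or, Finset.not_subset, Finset.not_subset] at hIJ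
      rcases hIJ with ⟨i, hi, hi'⟩ | ⟨i, hi, hi'⟩
      · have him : i ∈ normal χ mu := by
          by_contra hc
          exact hi' ((htang i).mpr ⟨hI hi, (mem_tang_iff_notMem_normal χ).mpr hc⟩)
        by_cases hz : I.sort.get z = i
        · rw [hz, pderiv_extendFn_of_mem_normal χ him]; simp
        · have hmem : i ∈ I.sort.eraseIdx z := by
            rw [List.mem_eraseIdx_iff_getElem]
            obtain ⟨w, hw⟩ := List.get_of_mem ((Finset.mem_sort (· ≤ ·)).mpr hi)
            exact ⟨w, w.2, fun h' => hz (by rw [← hw]; congr 1; exact (Fin.ext h').symm), hw⟩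
          have : wedge (I.sort.eraseIdx z) * wedge J.sort * Lam χ lam * Lam χ mu = 0 := by
            rw [Lam_eq, Lam_eq, ← wedge_append, ← wedge_append]
            exact wedge_mul_eq_zero (i := i) (by simp [hmem]) (by simp [him])
          rw [this]; simp
      · have him : i ∈ normal χ lam := by
          by_contra hc
          exact hi' ((htang i).mpr ⟨(mem_tang_iff_notMem_normal χ).mpr hc, hJ hi⟩)
        have : wedge (I.sort.eraseIdx z) * wedge J.sort * Lam χ lam * Lam χ mu = 0 := by
          rw [Lam_eq, ← wedge_append, wedge_mul_eq_zero (i := i) (by simp [hi]) (by simp [him]),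
            zero_mul]
        rw [this]; simp

/-- Removing a member of a list from the front of the corresponding monomial. -/
theorem exists_contr_wedge_eq {q : Fin n} {L : List (Fin n)} (hL : L.Nodup) (hq : q ∈ L) :
    ∃ ε : ℂ, contr q (wedge L) = ε • wedge (L.erase q) ∧
      wedge L = ε • (wedge [q] * wedge (L.erase q)) := by
  obtain ⟨ε, hε⟩ := wedge_perm (List.perm_cons_erase hq)
  have h2 : wedge L = ((ε : ℤ) : ℂ) • (wedge [q] * wedge (L.erase q)) := by
    rw [hε, Units.smul_def, Int.cast_smul_eq_zsmul, ← wedge_append]; rfl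
  refine ⟨((ε : ℤ) : ℂ), ?_, h2⟩
  have h3 : contr q (wedge (q :: L.erase q)) = wedge (L.erase q) := by
    rw [contr_wedge_cons, if_pos rfl, one_smul,
      contr_wedge_eq_zero (fun h => (List.Nodup.mem_erase_iff hL).mp h |>.1 rfl), mul_zero,
      sub_zero]
  have h4 : wedge [q] * wedge (L.erase q) = wedge (q :: L.erase q) := by
    rw [← wedge_append]; rfl
  rw [h2, map_smul, h4, h3]

/-- Once `∂_q` has been contracted out of `Λ_λ`, only `∂_J` can supply it for `Λ_g`. -/
theorem projSec_contr_Lam_of_notMem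
    (hg : ∀ i, i ∈ normal χ g ↔ i ∈ normal χ lam ∨ i ∈ normal χ mu)
    (hd : ∀ i ∈ normal χ lam, i ∉ normal χ mu) {I J : Finset (Fin n)} (hI : I ⊆ tang χ lam)
    {q : Fin n} (hq : q ∈ normal χ lam) (hqJ : q ∉ J) (N : ℕ) :
    projSec χ g N (wedge I.sort * contr q (Lam χ lam) * (wedge J.sort * Lam χ mu)) = 0 := by
  obtain ⟨ε, h1, -⟩ := exists_contr_wedge_eq (q := q) (L := (normal χ lam).sort)
    (Finset.sort_nodup _ _) (by simp [hq])
  rw [Lam_eq, Lam_eq, h1, mul_smul_comm, smul_mul_assoc, map_smul, ← wedge_append, ← wedge_append,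
    ← wedge_append, projSec_wedge_of_notMem χ ((hg q).mpr (Or.inl hq)), smul_zero]
  have hqI : q ∉ I := fun h => (mem_tang_iff_notMem_normal χ).mp (hI h) hq
  simp [hqI, hqJ, hd q hq, (Finset.sort_nodup (normal χ lam) (· ≤ ·)).mem_erase_iff]

/-- For a coordinate `x^q` moved by `λ`, the projection of the term in which `∂_q` is contracted out of
`Λ_λ` selects the coefficients of `Y` with last index `q`, whose factor `∂_q` takes the free place in
`Λ_λ`. -/
theorem sum_extCoeff_smul_eq_projSec
    (hg : ∀ i, i ∈ normal χ g ↔ i ∈ normal χ lam ∨ i ∈ normal χ mu)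
    (hd : ∀ i ∈ normal χ lam, i ∉ normal χ mu) {I J : Finset (Fin n)} (hI : I ⊆ tang χ lam)
    (hJ : J ⊆ tang χ mu) (hk : I.card + codim χ lam = k) (hl : J.card + codim χ mu = l)
    {q : Fin n} (hq : q ∈ normal χ lam) :
    ∑ J' ∈ (tang χ g).powersetCard (J.card - 1),
      extCoeff ((J'.sort ++ [q]) ++ (normal χ mu).sort) (wedge J.sort * Lam χ mu) •
        (wedge I.sort * wedge J'.sort * Lam χ lam * Lam χ mu) =
      (-1 : ℂ) ^ ((codim χ lam - 1) * J.card) • projSec χ g (k + l - 1)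
        (wedge I.sort * contr q (Lam χ lam) * (wedge J.sort * Lam χ mu)) := by
  have htang : ∀ i, i ∈ tang χ g ↔ i ∈ tang χ lam ∧ i ∈ tang χ mu := fun i => by
    simp only [mem_tang_iff_notMem_normal, hg]; tauto
  by_cases hqJ : q ∈ J
  swap
  · rw [projSec_contr_Lam_of_notMem χ hg hd hI hq hqJ, smul_zero]
    refine Finset.sum_eq_zero fun J' _ => ?_
    rw [Lam_eq χ mu, ← wedge_append, extCoeff_wedge_of_notMem (i := q), zero_smul]
    · simp
    · simp [hqJ, hd q hq]
  have hnl : (normal χ lam).sort.Nodup := Finset.sort_nodup _ _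
  have hqn : q ∈ (normal χ lam).sort := by simp [hq]
  obtain ⟨ε, hc1, hc2⟩ := exists_contr_wedge_eq hnl hqn
  set R := (normal χ lam).sort.erase q with hR
  have hRlen : R.length = codim χ lam - 1 := by
    rw [hR, List.length_erase_of_mem hqn, length_sort_normal]
  have hcodim : 0 < codim χ lam := Finset.card_pos.mpr ⟨q, hq⟩
  have hJpos : 0 < J.card := Finset.card_pos.mpr ⟨q, hqJ⟩
  -- `J` is rearranged so that `q` comes last
  have hperm : J.sort.Perm ((J.erase q).sort ++ [q]) := by
    refine (List.perm_ext_iff_of_nodup (Finset.sort_nodup _ _) ?_).mpr fun i => ?_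
    · refine List.nodup_append.mpr ⟨Finset.sort_nodup _ _, List.nodup_singleton q, ?_⟩
      rintro a ha b hb rfl
      simp at ha hb
      exact ha.1 hb
    · simp only [Finset.mem_sort, List.mem_append, Finset.mem_erase, List.mem_singleton]
      by_cases hi : i = q
      · subst hi; simp [hqJ]
      · simp [hi]
  obtain ⟨ε', hε'⟩ := wedge_perm hperm
  have hnd : ∀ J' : Finset (Fin n), J' ⊆ tang χ g →
      ((J'.sort ++ [q]) ++ (normal χ mu).sort).Nodup := by
    intro J' hJ'
    have hqJ' : q ∉ J' := fun h =>
      (mem_tang_iff_notMem_normal χ).mp ((htang q).mp (hJ' h)).1 hq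
    refine List.nodup_append.mpr ⟨List.nodup_append.mpr ⟨Finset.sort_nodup _ _,
      List.nodup_singleton q, ?_⟩, Finset.sort_nodup _ _, ?_⟩
    · rintro a ha b hb rfl
      simp at ha hb
      exact hqJ' (hb ▸ ha)
    · rintro a ha b hb rfl
      simp only [List.mem_append, Finset.mem_sort, List.mem_singleton] at ha hb
      rcases ha with ha | rfl
      · exact (mem_tang_iff_notMem_normal χ).mp ((htang a).mp (hJ' ha)).2 hb
      · exact hd a hq hb
  have hcoef : ∀ J' : Finset (Fin n), J' ⊆ tang χ g →
      extCoeff ((J'.sort ++ [q]) ++ (normal χ mu).sort) (wedge J.sort * Lam χ mu) =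
        if J' = J.erase q then ((ε' : ℤ) : ℂ) else 0 := by
    intro J' hJ'
    rw [hε', Lam_eq, smul_mul_assoc, ← wedge_append, Units.smul_def, ← Int.cast_smul_eq_zsmul ℂ,
      map_smul]
    split_ifs with h
    · subst h
      rw [extCoeff_wedge_self (hnd _ hJ'), smul_eq_mul, mul_one]
    · have : extCoeff ((J'.sort ++ [q]) ++ (normal χ mu).sort)
          (wedge (((J.erase q).sort ++ [q]) ++ (normal χ mu).sort)) = 0 := by
        by_contra h0
        have hp := perm_of_extCoeff_wedge_ne_zero (hnd _ hJ') h0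
        have hp' := (List.perm_append_right_iff _).mp ((List.perm_append_right_iff _).mp hp)
        exact h (Finset.ext fun i => by simpa using hp'.mem_iff (a := i))
      rw [this, smul_zero]
  have hform : wedge I.sort * contr q (Lam χ lam) * (wedge J.sort * Lam χ mu) =
      ε • wedge (I.sort ++ R ++ (J.sort ++ (normal χ mu).sort)) := by
    rw [Lam_eq, hc1, wedge_append, wedge_append, wedge_append, Lam_eq, mul_smul_comm,
      smul_mul_assoc]
  have hproj : projSec χ g (k + l - 1) (wedge (I.sort ++ R ++ (J.sort ++ (normal χ mu).sort))) =
      wedge (I.sort ++ R ++ (J.sort ++ (normal χ mu).sort)) := by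
    refine projSec_wedge_of_forall_mem χ ?_ fun i hi => ?_
    · rw [List.length_append, List.length_append, List.length_append, hRlen, length_sort_normal,
        Finset.length_sort, Finset.length_sort]
      omega
    · simp only [List.mem_append, Finset.mem_sort, hR]
      rcases (hg i).mp hi with hi | hi
      · by_cases hiq : i = q
        · subst hiq; simp [hqJ]
        · left; right
          rw [hnl.mem_erase_iff]
          exact ⟨hiq, by simp [hi]⟩
      · simp [hi]
  rw [hform, map_smul, hproj]
  by_cases hJ1 : J.erase q ⊆ tang χ g
  · rw [Finset.sum_eq_single_of_mem (J.erase q)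
      (Finset.mem_powersetCard.mpr ⟨hJ1, Finset.card_erase_of_mem hqJ⟩), hcoef _ hJ1, if_pos rfl]
    · have hcomm := wedge_mul_comm R J.sort
      rw [hRlen, Finset.length_sort] at hcomm
      have hsq : (-1 : ℂ) ^ ((codim χ lam - 1) * J.card) *
          (-1 : ℂ) ^ ((codim χ lam - 1) * J.card) = 1 := by
        rw [← mul_pow, neg_mul_neg, one_mul, one_pow]
      have hw : wedge (I.sort ++ R ++ (J.sort ++ (normal χ mu).sort)) =
          wedge I.sort * (wedge R * wedge J.sort) * wedge (normal χ mu).sort := by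
        simp only [wedge_append, mul_assoc]
      rw [hw, hcomm, Lam_eq χ lam, hc2, hε', Units.smul_def, ← Int.cast_smul_eq_zsmul ℂ,
        wedge_append, Lam_eq]
      simp only [smul_mul_assoc, mul_smul_comm, smul_smul, mul_assoc]
      congr 1
      linear_combination (-((ε' : ℤ) : ℂ) * ε) * hsq
    · intro J' hJ' hne
      rw [hcoef _ (Finset.mem_powersetCard.mp hJ').1, if_neg hne, zero_smul]
  · rw [Finset.sum_eq_zero]
    · obtain ⟨i, hi, hi'⟩ := Finset.not_subset.mp hJ1
      obtain ⟨hiq, hiJ⟩ := Finset.mem_erase.mp hi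
      have him : i ∈ normal χ lam := by
        by_contra hc
        exact hi' ((htang i).mpr ⟨(mem_tang_iff_notMem_normal χ).mpr hc, hJ hiJ⟩)
      have hiR : i ∈ R := hnl.mem_erase_iff.mpr ⟨hiq, by simp [him]⟩
      rw [wedge_append, wedge_mul_eq_zero (i := i) (by simp [hiR]) (by simp [hiJ]), smul_zero,
        smul_zero]
    · intro J' hJ'
      have hJ'g := (Finset.mem_powersetCard.mp hJ').1
      rw [hcoef _ hJ'g, if_neg (fun h : J' = J.erase q => hJ1 (h ▸ hJ'g)), zero_smul]

/-- The part of the bracket in which `Λ_λ` is contracted, for sections with a single coefficient. -/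
theorem normalTerm_basis (hg : ∀ i, i ∈ normal χ g ↔ i ∈ normal χ lam ∨ i ∈ normal χ mu)
    (hd : ∀ i ∈ normal χ lam, i ∉ normal χ mu)
    {I J : Finset (Fin n)} (hI : I ⊆ tang χ lam) (hJ : J ⊆ tang χ mu)
    (hk : I.card + codim χ lam = k) (hl : J.card + codim χ mu = l)
    (f : PolyFix χ lam) (h : PolyFix χ mu) :
    normalTerm χ g lam mu k l (f ⊗ₜ[ℂ] (wedge I.sort * Lam χ lam))
        (h ⊗ₜ[ℂ] (wedge J.sort * Lam χ mu)) =
      (-1 : ℂ) ^ (l * (k - 1) + I.card) • ∑ q,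
        restrictFn χ g (extendFn χ lam f * pderiv q (extendFn χ mu h)) ⊗ₜ[ℂ]
          projSec χ g (k + l - 1)
            (wedge I.sort * contr q (Lam χ lam) * (wedge J.sort * Lam χ mu)) := by
  have htang : ∀ i, i ∈ tang χ g ↔ i ∈ tang χ lam ∧ i ∈ tang χ mu := fun i => by
    simp only [mem_tang_iff_notMem_normal, hg]; tauto
  rw [← Finset.sum_subset (Finset.subset_univ (normal χ lam))]
  swap
  · intro q _ hq
    rw [Lam_eq χ lam, contr_wedge_eq_zero (by simpa using hq)]
    simp
  rw [normalTerm]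
  split_ifs with hpos
  swap
  · have hJ0 : J = ∅ := Finset.card_eq_zero.mp (by omega)
    -- both sides vanish: `Y` is a function, so nothing can replace the contracted `∂_q`
    subst hJ0
    rw [Finset.sum_eq_zero, smul_zero]
    intro q hq
    rw [projSec_contr_Lam_of_notMem χ hg hd hI hq (Finset.notMem_empty q),
      TensorProduct.tmul_zero]
  have hJcard : l - codim χ mu - 1 = J.card - 1 := by omega
  by_cases hIg : I ⊆ tang χ g
  · rw [Finset.sum_eq_single_of_mem I (Finset.mem_powersetCard.mpr ⟨hIg, by omega⟩)]
    swap
    · intro I' hI' hne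
      have hI't : I' ⊆ tang χ lam := fun i hi =>
        ((htang i).mp ((Finset.mem_powersetCard.mp hI').1 hi)).1
      simp [coeffX_basis χ hI hI't, hne]
    rw [Finset.sum_comm, Finset.smul_sum]
    refine Finset.sum_congr rfl fun q hq => ?_
    have hcodim : 0 < codim χ lam := Finset.card_pos.mpr ⟨q, hq⟩
    have key := congrArg (fun e => (-1 : ℂ) ^ (l * (k - 1) + I.card +
        (codim χ lam - 1) * J.card) •
        (restrictFn χ g (extendFn χ lam f * pderiv q (extendFn χ mu h)) ⊗ₜ[ℂ] e))
      (sum_extCoeff_smul_eq_projSec χ hg hd hI hJ hk hl hq)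
    have hsq : (-1 : ℂ) ^ ((codim χ lam - 1) * J.card) *
        (-1 : ℂ) ^ ((codim χ lam - 1) * J.card) = 1 := by
      rw [← mul_pow, neg_mul_neg, one_mul, one_pow]
    simp only [TensorProduct.tmul_smul, smul_smul] at key
    rw [pow_add _ (l * (k - 1) + I.card), mul_assoc, hsq, mul_one, ← pow_add] at key
    rw [← key, TensorProduct.tmul_sum, Finset.smul_sum, hJcard]
    refine Finset.sum_congr rfl fun J' hJ' => ?_
    rw [coeffX_basis χ hI hI, if_pos rfl, coeffX_tmul, map_smul, Derivation.map_smul, mul_smul_comm,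
      map_smul, ← TensorProduct.smul_tmul', TensorProduct.tmul_smul]
    refine negOnePow_smul_eq _ _ ⟨-(I.card : ℤ) - J.card * (codim χ lam - 1), ?_⟩ _
    have hk1 : ((k - 1 : ℕ) : ℤ) = k - 1 := by omega
    have hc1 : ((codim χ lam - 1 : ℕ) : ℤ) = codim χ lam - 1 := by omega
    have hJ' : (J.card : ℤ) = l - codim χ mu := by omega
    have hI' : (I.card : ℤ) = k - codim χ lam := by omega
    push_cast [hk1, hc1, hJ', hI']
    ring
  · -- `∂_I` contains some `∂_i` normal to `V^μ`, which occurs in `Λ_μ` as well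
    trans (0 : MVFix χ g)
    · refine Finset.sum_eq_zero fun I' hI' => Finset.sum_eq_zero fun J' hJ' =>
        Finset.sum_eq_zero fun z _ => ?_
      have hI'g := (Finset.mem_powersetCard.mp hI').1
      rw [coeffX_basis χ hI fun i hi => ((htang i).mp (hI'g hi)).1,
        if_neg (fun h : I' = I => hIg (h ▸ hI'g))]
      simp
    · symm
      rw [Finset.sum_eq_zero, smul_zero]
      intro q hq
      obtain ⟨i, hi, hi'⟩ := Finset.not_subset.mp hIg
      have him : i ∈ normal χ mu := by
        by_contra hc
        exact hi' ((htang i).mpr ⟨hI hi, (mem_tang_iff_notMem_normal χ).mpr hc⟩)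
      obtain ⟨ε, h1, -⟩ := exists_contr_wedge_eq (q := q) (L := (normal χ lam).sort)
        (Finset.sort_nodup _ _) (by simp [hq])
      have : wedge I.sort * contr q (Lam χ lam) * (wedge J.sort * Lam χ mu) = 0 := by
        rw [Lam_eq, Lam_eq, h1, mul_smul_comm, smul_mul_assoc, ← wedge_append, ← wedge_append,
          wedge_mul_eq_zero (i := i) (by simp [hi]) (by simp [him]), smul_zero]
      rw [this, map_zero, TensorProduct.tmul_zero]

theorem tangentialTerm_add_left (ξ ξ' : MVFix χ lam) (η : MVFix χ mu) :
    tangentialTerm χ g lam mu k l (ξ + ξ') η =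
      tangentialTerm χ g lam mu k l ξ η + tangentialTerm χ g lam mu k l ξ' η := by
  simp only [tangentialTerm, coeffX, map_add, add_mul, TensorProduct.add_tmul, smul_add,
    Finset.sum_add_distrib]

theorem tangentialTerm_add_right (ξ : MVFix χ lam) (η η' : MVFix χ mu) :
    tangentialTerm χ g lam mu k l ξ (η + η') =
      tangentialTerm χ g lam mu k l ξ η + tangentialTerm χ g lam mu k l ξ η' := by
  simp only [tangentialTerm, coeffX, map_add, mul_add, TensorProduct.add_tmul, smul_add,
    Finset.sum_add_distrib]

theorem tangentialTerm_smul_left (c : ℂ) (ξ : MVFix χ lam) (η : MVFix χ mu) :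
    tangentialTerm χ g lam mu k l (c • ξ) η = c • tangentialTerm χ g lam mu k l ξ η := by
  simp only [tangentialTerm, coeffX, map_smul, smul_mul_assoc, ← TensorProduct.smul_tmul',
    Finset.smul_sum, smul_comm c]

theorem tangentialTerm_smul_right (c : ℂ) (ξ : MVFix χ lam) (η : MVFix χ mu) :
    tangentialTerm χ g lam mu k l ξ (c • η) = c • tangentialTerm χ g lam mu k l ξ η := by
  simp only [tangentialTerm, coeffX, map_smul, Derivation.map_smul, mul_smul_comm,
    ← TensorProduct.smul_tmul', Finset.smul_sum, smul_comm c]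

theorem normalTerm_add_left (ξ ξ' : MVFix χ lam) (η : MVFix χ mu) :
    normalTerm χ g lam mu k l (ξ + ξ') η =
      normalTerm χ g lam mu k l ξ η + normalTerm χ g lam mu k l ξ' η := by
  simp only [normalTerm]
  split_ifs
  · simp only [coeffX, map_add, add_mul, TensorProduct.add_tmul, smul_add, Finset.sum_add_distrib]
  · rw [add_zero]

theorem normalTerm_add_right (ξ : MVFix χ lam) (η η' : MVFix χ mu) :
    normalTerm χ g lam mu k l ξ (η + η') =
      normalTerm χ g lam mu k l ξ η + normalTerm χ g lam mu k l ξ η' := by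
  simp only [normalTerm]
  split_ifs
  · simp only [coeffX, map_add, mul_add, TensorProduct.add_tmul, smul_add, Finset.sum_add_distrib]
  · rw [add_zero]

theorem normalTerm_smul_left (c : ℂ) (ξ : MVFix χ lam) (η : MVFix χ mu) :
    normalTerm χ g lam mu k l (c • ξ) η = c • normalTerm χ g lam mu k l ξ η := by
  simp only [normalTerm]
  split_ifs
  · simp only [coeffX, map_smul, smul_mul_assoc, ← TensorProduct.smul_tmul', Finset.smul_sum,
      smul_comm c]
  · rw [smul_zero]

theorem normalTerm_smul_right (c : ℂ) (ξ : MVFix χ lam) (η : MVFix χ mu) :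
    normalTerm χ g lam mu k l ξ (c • η) = c • normalTerm χ g lam mu k l ξ η := by
  simp only [normalTerm]
  split_ifs
  · simp only [coeffX, map_smul, Derivation.map_smul, mul_smul_comm, ← TensorProduct.smul_tmul',
      Finset.smul_sum, smul_comm c]
  · rw [smul_zero]

theorem tangentialTerm_zero_left (η : MVFix χ mu) : tangentialTerm χ g lam mu k l 0 η = 0 := by
  simpa using tangentialTerm_smul_left χ (g := g) (k := k) (l := l) 0 (0 : MVFix χ lam) η

theorem tangentialTerm_zero_right (ξ : MVFix χ lam) :
    tangentialTerm χ g lam mu k l ξ 0 = 0 := by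
  simpa using tangentialTerm_smul_right χ (g := g) (k := k) (l := l) 0 ξ (0 : MVFix χ mu)

theorem normalTerm_zero_left (η : MVFix χ mu) : normalTerm χ g lam mu k l 0 η = 0 := by
  simpa using normalTerm_smul_left χ (g := g) (k := k) (l := l) 0 (0 : MVFix χ lam) η

theorem normalTerm_zero_right (ξ : MVFix χ lam) : normalTerm χ g lam mu k l ξ 0 = 0 := by
  simpa using normalTerm_smul_right χ (g := g) (k := k) (l := l) 0 ξ (0 : MVFix χ mu)

/-- The terms of the formula are the two parts of the projected bracket, in which the contraction
`ι_{dx^q}` acts on `X` and on `Λ_λ`, respectively. -/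
theorem tangentialTerm_add_normalTerm
    (hg : ∀ i, i ∈ normal χ g ↔ i ∈ normal χ lam ∨ i ∈ normal χ mu)
    (hd : ∀ i ∈ normal χ lam, i ∉ normal χ mu) {ξ : MVFix χ lam} (hξ : ξ ∈ Sec χ lam k)
    {η : MVFix χ mu} (hη : η ∈ Sec χ mu l) :
    tangentialTerm χ g lam mu k l ξ η + normalTerm χ g lam mu k l ξ η =
      (projSec χ g (k + l - 1)).lTensor (PolyFix χ g) (restrictMV χ g
        ((-1 : ℂ) ^ (l * (k - 1)) • bracket (extSec χ lam ξ) (extSec χ mu η))) := by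
  induction hξ using Submodule.span_induction with
  | zero => simp [tangentialTerm_zero_left, normalTerm_zero_left]
  | add x y _ _ hx hy =>
    rw [tangentialTerm_add_left, normalTerm_add_left, add_add_add_comm, hx, hy, map_add, map_add,
      LinearMap.add_apply, smul_add, map_add, map_add]
  | smul c x _ hx =>
    rw [tangentialTerm_smul_left, normalTerm_smul_left, ← smul_add, hx]
    simp only [map_smul, LinearMap.smul_apply]
    rw [smul_comm]
  | mem x hx =>
  obtain ⟨I, f, hI, hk, rfl⟩ := hx
  induction hη using Submodule.span_induction with
  | zero => simp [tangentialTerm_zero_right, normalTerm_zero_right]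
  | add x y _ _ hx hy =>
    rw [tangentialTerm_add_right, normalTerm_add_right, add_add_add_comm, hx, hy, map_add, map_add,
      smul_add, map_add, map_add]
  | smul c x _ hx =>
    rw [tangentialTerm_smul_right, normalTerm_smul_right, ← smul_add, hx]
    simp only [map_smul]
    rw [smul_comm]
  | mem x hx =>
    obtain ⟨J, h, hJ, hl, rfl⟩ := hx
    rw [tangentialTerm_basis χ hg hI hJ hk hl, normalTerm_basis χ hg hd hI hJ hk hl, pow_add,
      mul_smul, ← smul_add, map_smul, map_smul]
    congr 1
    rw [bracket_apply, map_sum, map_sum, Finset.smul_sum, ← Finset.sum_add_distrib]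
    refine Finset.sum_congr rfl fun q _ => ?_
    rw [extSec, extSec, LinearMap.rTensor_tmul, LinearMap.rTensor_tmul, LinearMap.lTensor_tmul,
      LinearMap.rTensor_tmul, Algebra.TensorProduct.tmul_mul_tmul, restrictMV_tmul,
      LinearMap.lTensor_tmul, Lam_eq χ lam, contr_wedge_append, add_mul, map_add,
      TensorProduct.tmul_add, smul_mul_assoc, map_smul, TensorProduct.tmul_smul,
      Finset.length_sort]
    rfl

end Formula

/-! ### Fixed spaces and their complements -/

section Geometry

variable {G V : Type*} [CommGroup G] [AddCommGroup V] [Module ℝ V] {ρ : Representation ℝ G V}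

theorem mem_fixedSpace {g : G} {v : V} : v ∈ fixedSpace ρ g ↔ ρ g v = v := by
  simp [fixedSpace, sub_eq_zero]

theorem mem_normalSpace {g : G} {v : V} : v ∈ normalSpace ρ g ↔ ∃ w, ρ g w - w = v := by
  simp [normalSpace]

theorem rep_comm (g h : G) (v : V) : ρ g (ρ h v) = ρ h (ρ g v) := by
  rw [← Module.End.mul_apply, ← Module.End.mul_apply, ← map_mul, ← map_mul, mul_comm]

theorem fixedSpace_inf_le_mul (g h : G) :
    fixedSpace ρ g ⊓ fixedSpace ρ h ≤ fixedSpace ρ (g * h) := by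
  rintro v ⟨h1, h2⟩
  rw [SetLike.mem_coe, mem_fixedSpace] at h1 h2
  rw [mem_fixedSpace, map_mul, Module.End.mul_apply, h2, h1]

/-- `(g - 1) (h - 1)` vanishes on both fixed spaces, hence everywhere. -/
theorem normalSpace_le_fixedSpace_of_sup_eq_top {g h : G}
    (hgh : fixedSpace ρ g ⊔ fixedSpace ρ h = ⊤) : normalSpace ρ g ≤ fixedSpace ρ h := by
  intro v hv
  obtain ⟨w, rfl⟩ := mem_normalSpace.mp hv
  obtain ⟨a, ha, b, hb, rfl⟩ := Submodule.mem_sup.mp (hgh ▸ Submodule.mem_top : w ∈ _)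
  rw [mem_fixedSpace] at ha hb ⊢
  have : ρ g (a + b) - (a + b) = ρ g b - b := by rw [map_add, ha]; abel
  rw [this, map_sub, rep_comm, hb]

variable {n : ℕ} {χ : Fin n → G →* ℂˣ} {x : Module.Basis (Fin n) ℂ (V →ₗ[ℝ] ℂ)}

/-- Complex linear coordinates separate points, as every real functional is a complex combination of
them. -/
theorem eq_zero_of_forall_coord_eq_zero [FiniteDimensional ℝ V]
    (x : Module.Basis (Fin n) ℂ (V →ₗ[ℝ] ℂ)) {v : V} (h : ∀ i, x i v = 0) : v = 0 := by
  refine (Module.forall_dual_apply_eq_zero_iff ℝ v).mp fun φ => ?_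
  have h1 : ∀ F : V →ₗ[ℝ] ℂ, F v = 0 := by
    intro F
    have h2 : (∑ i, x.repr F i • x i) v = 0 := by
      rw [LinearMap.sum_apply]
      exact Finset.sum_eq_zero fun i _ => by rw [LinearMap.smul_apply, h, smul_zero]
    rwa [x.sum_repr] at h2
  exact Complex.ofReal_eq_zero.mp (h1 (Complex.ofRealCLM.toLinearMap ∘ₗ φ))

theorem coord_rep (hχ : IsEigenCoordinates ρ x χ) (g : G) (i : Fin n) (v : V) :
    x i (ρ g v) = (χ i g⁻¹ : ℂ) * x i v := by
  have := hχ i g⁻¹ v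
  rwa [inv_inv] at this

theorem disjoint_fixedSpace_normalSpace [FiniteDimensional ℝ V]
    (hχ : IsEigenCoordinates ρ x χ) (g : G) :
    Disjoint (fixedSpace ρ g) (normalSpace ρ g) := by
  rw [Submodule.disjoint_def]
  intro v hv hv'
  obtain ⟨w, rfl⟩ := mem_normalSpace.mp hv'
  rw [mem_fixedSpace] at hv
  refine eq_zero_of_forall_coord_eq_zero x fun i => ?_
  have h1 := congrArg (x i) hv
  rw [coord_rep hχ, map_sub, coord_rep hχ] at h1
  rw [map_sub, coord_rep hχ]
  have h2 : ((χ i g⁻¹ : ℂ) - 1) * (((χ i g⁻¹ : ℂ) - 1) * x i w) = 0 := by linear_combination h1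
  rcases mul_eq_zero.mp h2 with h3 | h3
  · linear_combination x i w * h3
  · linear_combination h3

theorem fixedSpace_sup_normalSpace [FiniteDimensional ℝ V] (hχ : IsEigenCoordinates ρ x χ)
    (g : G) : fixedSpace ρ g ⊔ normalSpace ρ g = ⊤ := by
  refine Submodule.eq_top_of_disjoint _ _ ?_ (disjoint_fixedSpace_normalSpace hχ g)
  rw [add_comm]
  exact (LinearMap.finrank_range_add_finrank_ker (ρ g - 1)).ge

/-- If no coordinate is moved by both `λ` and `μ`, then `(λ - 1) (μ - 1) = 0`, whence the fixed
spaces span. -/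
theorem sup_fixedSpace_eq_top [FiniteDimensional ℝ V] (hχ : IsEigenCoordinates ρ x χ)
    {lam mu : G} (hd : ∀ i ∈ normal χ lam, i ∉ normal χ mu) :
    fixedSpace ρ lam ⊔ fixedSpace ρ mu = ⊤ := by
  have h1 : normalSpace ρ mu ≤ fixedSpace ρ lam := by
    intro v hv
    obtain ⟨w, rfl⟩ := mem_normalSpace.mp hv
    rw [mem_fixedSpace, ← sub_eq_zero]
    refine eq_zero_of_forall_coord_eq_zero x fun i => ?_
    rw [map_sub, coord_rep hχ, map_sub, coord_rep hχ]
    by_cases hi : i ∈ normal χ lam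
    · have := hd i hi
      rw [← mem_tang_iff_notMem_normal, mem_tang] at this
      rw [map_inv (χ i) mu, this]; simp
    · rw [← mem_tang_iff_notMem_normal, mem_tang] at hi
      rw [map_inv (χ i) lam, hi]; simp
  rw [eq_top_iff, ← fixedSpace_sup_normalSpace hχ mu, sup_comm]
  exact sup_le_sup_right h1 _

theorem fixedSpace_decomposition [FiniteDimensional ℝ V] (hχ : IsEigenCoordinates ρ x χ)
    {α β : G} (h : fixedSpace ρ α ⊔ fixedSpace ρ β = ⊤) :
    DirectSum.IsInternal ![fixedSpace ρ (α * β), normalSpace ρ α, normalSpace ρ β] ∧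
      fixedSpace ρ α = fixedSpace ρ (α * β) ⊔ normalSpace ρ β ∧
      fixedSpace ρ β = fixedSpace ρ (α * β) ⊔ normalSpace ρ α ∧
      codim χ (α * β) = codim χ α + codim χ β := by
  have hNα := normalSpace_le_fixedSpace_of_sup_eq_top h
  have hNβ := normalSpace_le_fixedSpace_of_sup_eq_top (by rwa [sup_comm] at h :
    fixedSpace ρ β ⊔ fixedSpace ρ α = ⊤)
  have hdα := Submodule.disjoint_def.mp (disjoint_fixedSpace_normalSpace hχ α)
  have hdβ := Submodule.disjoint_def.mp (disjoint_fixedSpace_normalSpace hχ β)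
  -- `αβ - 1 = (α - 1) + (β - 1)`, and the ranges of the two summands are independent
  have hF : fixedSpace ρ (α * β) ≤ fixedSpace ρ α ⊓ fixedSpace ρ β := by
    intro v hv
    rw [mem_fixedSpace, map_mul, Module.End.mul_apply] at hv
    have h1 : ρ α v - v ∈ normalSpace ρ α := mem_normalSpace.mpr ⟨v, rfl⟩
    have h2 : ρ β v - v ∈ normalSpace ρ β := mem_normalSpace.mpr ⟨v, rfl⟩
    have h3 : ρ α (ρ β v - v) = ρ β v - v := mem_fixedSpace.mp (hNβ h2)
    rw [map_sub, hv] at h3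
    have h4 : ρ β v - v = 0 := by
      refine hdβ _ (hNα ?_) h2
      rw [← h3]
      have := (normalSpace ρ α).neg_mem h1
      rwa [neg_sub] at this
    have h5 : ρ α v - v = 0 := by
      rw [h4, sub_eq_zero] at h3
      rw [← h3, sub_self]
    exact ⟨mem_fixedSpace.mpr (sub_eq_zero.mp h5), mem_fixedSpace.mpr (sub_eq_zero.mp h4)⟩
  have hFα := hF.trans inf_le_left
  have hFβ := hF.trans inf_le_right
  have hinf := fixedSpace_inf_le_mul (ρ := ρ) α β
  have hα : fixedSpace ρ α = fixedSpace ρ (α * β) ⊔ normalSpace ρ β := by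
    refine le_antisymm (fun v hv => ?_) (sup_le hFα hNβ)
    obtain ⟨b, hb, c, hc, rfl⟩ := Submodule.mem_sup.mp
      (fixedSpace_sup_normalSpace hχ β ▸ Submodule.mem_top : v ∈ _)
    refine Submodule.add_mem_sup (hinf ⟨?_, hb⟩) hc
    have := (fixedSpace ρ α).sub_mem hv (hNβ hc)
    rwa [add_sub_cancel_right] at this
  have hβ : fixedSpace ρ β = fixedSpace ρ (α * β) ⊔ normalSpace ρ α := by
    refine le_antisymm (fun v hv => ?_) (sup_le hFβ hNα)
    obtain ⟨a, ha, c, hc, rfl⟩ := Submodule.mem_sup.mp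
      (fixedSpace_sup_normalSpace hχ α ▸ Submodule.mem_top : v ∈ _)
    refine Submodule.add_mem_sup (hinf ⟨ha, ?_⟩) hc
    have := (fixedSpace ρ β).sub_mem hv (hNα hc)
    rwa [add_sub_cancel_right] at this
  refine ⟨?_, hα, hβ, ?_⟩
  · refine DirectSum.isInternal_submodule_of_iSupIndep_of_iSup_eq_top ?_ ?_
    · refine iSupIndep_fin_three.mpr ⟨?_, ?_, ?_⟩
      · change Disjoint (fixedSpace ρ (α * β)) (normalSpace ρ α ⊔ normalSpace ρ β)
        rw [Submodule.disjoint_def]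
        intro v hv hv'
        obtain ⟨a, ha, b, hb, rfl⟩ := Submodule.mem_sup.mp hv'
        have h1 : a = 0 := by
          refine hdα _ ?_ ha
          have := (fixedSpace ρ α).sub_mem (hFα hv) (hNβ hb)
          rwa [add_sub_cancel_right] at this
        have h2 : b = 0 := by
          refine hdβ _ ?_ hb
          have := (fixedSpace ρ β).sub_mem (hFβ hv) (hNα ha)
          rwa [add_sub_cancel_left] at this
        rw [h1, h2, add_zero]
      · change Disjoint (normalSpace ρ α) (normalSpace ρ β ⊔ fixedSpace ρ (α * β))
        rw [sup_comm, ← hα]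
        exact (disjoint_fixedSpace_normalSpace hχ α).symm
      · change Disjoint (normalSpace ρ β) (fixedSpace ρ (α * β) ⊔ normalSpace ρ α)
        rw [← hβ]
        exact (disjoint_fixedSpace_normalSpace hχ β).symm
    · rw [eq_top_iff, ← fixedSpace_sup_normalSpace hχ α, hα]
      refine sup_le (sup_le ?_ ?_) ?_
      · exact le_iSup ![fixedSpace ρ (α * β), normalSpace ρ α, normalSpace ρ β] 0
      · exact le_iSup ![fixedSpace ρ (α * β), normalSpace ρ α, normalSpace ρ β] 2
      · exact le_iSup ![fixedSpace ρ (α * β), normalSpace ρ α, normalSpace ρ β] 1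
  · rw [codim_eq_finrank χ ρ x hχ, codim_eq_finrank χ ρ x hχ, codim_eq_finrank χ ρ x hχ]
    have hdim : ∀ g, Module.finrank ℝ (normalSpace ρ g) + Module.finrank ℝ (fixedSpace ρ g) =
        Module.finrank ℝ V := fun g => LinearMap.finrank_range_add_finrank_ker (ρ g - 1)
    have hd : Disjoint (fixedSpace ρ (α * β)) (normalSpace ρ β) :=
      (disjoint_fixedSpace_normalSpace hχ β).mono_left hFβ
    have h1 := Submodule.finrank_sup_add_finrank_inf_eq (fixedSpace ρ (α * β)) (normalSpace ρ β)
    rw [hd.eq_bot, finrank_bot, ← hα] at h1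
    have h2 := hdim α
    have h3 := hdim (α * β)
    omega

/-! ### The component of the product at a group element -/

theorem normal_mul_subset (lam mu : G) : normal χ (lam * mu) ⊆ normal χ lam ∪ normal χ mu := by
  intro i hi
  by_contra h
  rw [Finset.mem_union, not_or, ← mem_tang_iff_notMem_normal, ← mem_tang_iff_notMem_normal,
    mem_tang, mem_tang] at h
  rw [mem_normal, map_mul, h.1, h.2, one_mul] at hi
  exact hi rfl

theorem mem_normal_mul_iff {lam mu : G} (hd : ∀ i ∈ normal χ lam, i ∉ normal χ mu) (i : Fin n) :
    i ∈ normal χ (lam * mu) ↔ i ∈ normal χ lam ∨ i ∈ normal χ mu := by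
  have h1 := hd i
  refine ⟨fun h => Finset.mem_union.mp (normal_mul_subset lam mu h), fun hi => ?_⟩
  simp only [mem_normal, not_not, map_mul] at h1 hi ⊢
  rcases hi with hi | hi
  · rwa [h1 hi, mul_one]
  · have : χ i lam = 1 := by
      by_contra h2; exact hi (h1 h2)
    rwa [this, one_mul]

/-- The codimensions add up exactly if no coordinate is moved by both factors. -/
theorem codim_mul_eq_add_iff (lam mu : G) :
    codim χ (lam * mu) = codim χ lam + codim χ mu ↔
      ∀ i ∈ normal χ lam, i ∉ normal χ mu := by
  constructor
  · intro h
    refine Finset.disjoint_left.mp (Finset.card_union_eq_card_add_card.mp ?_)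
    refine le_antisymm (Finset.card_union_le _ _) ?_
    exact h.symm.le.trans (Finset.card_le_card (normal_mul_subset lam mu))
  · intro h
    rw [codim, codim, codim, ← Finset.card_union_of_disjoint (Finset.disjoint_left.mpr h)]
    congr 1
    ext i
    rw [mem_normal_mul_iff h, Finset.mem_union]

variable [Fintype G] {k l : ℕ} {ξ : ∀ g, Sec χ g k} {η : ∀ g, Sec χ g l}

theorem coe_L_preLie_eq_sum_insertionSymbol (hξ : IsGInvariant χ ξ) (hη : IsGInvariant χ η)
    (g : G) :
    (L χ (preLie (T χ ξ) (T χ η)) g : MVFix χ g) = ∑ mu : G,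
      (projSec χ g (k + l - 1)).lTensor (PolyFix χ g) (restrictMV χ g
        (insertionSymbol χ (g * mu⁻¹) mu k l (ξ (g * mu⁻¹)) (η mu))) := by
  rw [coe_L_preLie χ hξ hη, map_restrictFn_projSec, ← map_sum, ← map_sum]
  congr 2
  simp only [preLieComp, insertionSymbol, TensorProduct.sum_tmul, Finset.smul_sum,
    TensorProduct.smul_tmul']
  rw [Finset.sum_comm]
  refine Finset.sum_congr rfl fun mu _ => ?_
  rw [Finset.sum_comm]

open Classical in
/-- Pairs `(λ, μ)` that move a common coordinate contribute zero; the others are those for which the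
codimensions add up. -/
theorem coe_L_preLie_eq_sum (hξ : IsGInvariant χ ξ) (hη : IsGInvariant χ η) (g : G) :
    (L χ (preLie (T χ ξ) (T χ η)) g : MVFix χ g) =
      ∑ p : G × G with p.1 * p.2 = g ∧ codim χ g = codim χ p.1 + codim χ p.2,
        (tangentialTerm χ g p.1 p.2 k l (ξ p.1) (η p.2) +
          normalTerm χ g p.1 p.2 k l (ξ p.1) (η p.2)) := by
  rw [coe_L_preLie_eq_sum_insertionSymbol hξ hη]
  have hpairs : ∀ F : G × G → MVFix χ g, (∑ mu : G, F (g * mu⁻¹, mu)) =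
      ∑ p : G × G with p.1 * p.2 = g, F p := by
    intro F
    refine Finset.sum_bij (fun mu _ => (g * mu⁻¹, mu)) (by simp)
      (fun a _ b _ hab => congrArg Prod.snd hab) (fun p hp => ?_) (fun _ _ => rfl)
    refine ⟨p.2, Finset.mem_univ _, ?_⟩
    rw [← (Finset.mem_filter.mp hp).2, mul_inv_cancel_right]
  rw [hpairs fun p => (projSec χ g (k + l - 1)).lTensor (PolyFix χ g) (restrictMV χ g
    (insertionSymbol χ p.1 p.2 k l (ξ p.1) (η p.2))), ← Finset.filter_filter,
    Finset.sum_filter (fun p : G × G => codim χ g = codim χ p.1 + codim χ p.2)]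
  refine Finset.sum_congr rfl fun p hp => ?_
  obtain ⟨lam, mu⟩ := p
  obtain rfl : lam * mu = g := (Finset.mem_filter.mp hp).2
  split_ifs with hc
  · have hd := (codim_mul_eq_add_iff lam mu).mp hc
    have hg := mem_normal_mul_iff hd
    rw [tangentialTerm_add_normalTerm χ hg hd (ξ lam).2 (η mu).2]
    dsimp only
    rw [restrictMV_insertionSymbol χ (fun i hi => (hg i).mpr (Or.inl hi)) (ξ lam).2 (η mu).2]
  · have hnd : ¬ ∀ i ∈ normal χ lam, i ∉ normal χ mu := fun h =>
      hc ((codim_mul_eq_add_iff lam mu).mpr h)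
    push Not at hnd
    obtain ⟨i, hi, hi'⟩ := hnd
    dsimp only
    rw [insertionSymbol_eq_zero χ (η mu).2 hi hi', map_zero, map_zero]

end Geometry

end

end OrbifoldBracket

theorem mainTheorem4 {G V : Type*} [CommGroup G] [Fintype G]
    [AddCommGroup V] [Module ℝ V] [FiniteDimensional ℝ V] (ρ : Representation ℝ G V)
    {n : ℕ} (x : Module.Basis (Fin n) ℂ (V →ₗ[ℝ] ℂ)) (χ : Fin n → G →* ℂˣ)
    (hχ : IsEigenCoordinates ρ x χ)
    (k l : ℕ) (ξ : ∀ g, Sec χ g k) (η : ∀ g, Sec χ g l)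
    (hξ : IsGInvariant χ ξ) (hη : IsGInvariant χ η) :
    -- (1) no pair of components is transversal
    ((∀ α β : G, ξ α ≠ 0 → η β ≠ 0 → fixedSpace ρ α ⊔ fixedSpace ρ β ≠ ⊤) →
      ∀ g, L χ (preLie (T χ ξ) (T χ η)) g = 0) ∧
    -- (2), the decomposition
    (∀ α β : G, fixedSpace ρ α ⊔ fixedSpace ρ β = ⊤ →
      DirectSum.IsInternal ![fixedSpace ρ (α * β), normalSpace ρ α, normalSpace ρ β] ∧
      fixedSpace ρ α = fixedSpace ρ (α * β) ⊔ normalSpace ρ β ∧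
      fixedSpace ρ β = fixedSpace ρ (α * β) ⊔ normalSpace ρ α ∧
      codim χ (α * β) = codim χ α + codim χ β) ∧
    -- (2), the formula
    (∀ g : G, open Classical in
      (L χ (preLie (T χ ξ) (T χ η)) g : MVFix χ g) =
        ∑ p : G × G with p.1 * p.2 = g ∧ codim χ g = codim χ p.1 + codim χ p.2,
          (tangentialTerm χ g p.1 p.2 k l (ξ p.1) (η p.2) +
            normalTerm χ g p.1 p.2 k l (ξ p.1) (η p.2))) := by
  classical
  have key := coe_L_preLie_eq_sum (k := k) (l := l) hξ hη
  refine ⟨fun h g => ?_, fun α β => fixedSpace_decomposition hχ, key⟩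
  -- a pair that contributes to the formula is transversal, so one of its components vanishes
  apply Subtype.ext
  rw [key g]
  refine Finset.sum_eq_zero fun p hp => ?_
  obtain ⟨hpg, hc⟩ := (Finset.mem_filter.mp hp).2
  have hd := (codim_mul_eq_add_iff p.1 p.2).mp (by rw [hpg, hc])
  by_cases h1 : ξ p.1 = 0
  · rw [h1, Submodule.coe_zero, tangentialTerm_zero_left, normalTerm_zero_left, add_zero]
  · by_cases h2 : η p.2 = 0
    · rw [h2, Submodule.coe_zero, tangentialTerm_zero_right, normalTerm_zero_right, add_zero]
    · exact absurd (sup_fixedSpace_eq_top hχ hd) (h p.1 p.2 h1 h2)
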